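/- Let $A$ be a fixed integer $(r,s)\times t$ bimatrix with blocks $A_1\in\mathbb Z^{r\times t}$, $A_2\in\mathbb Z^{s\times t}$. For $n\ge 1$ let $A^{(n)}\in\mathbb Z^{(r+ns)\times nt}$ be its $n$-fold product: its first $r$ rows are $(A_1\ A_1\ \cdots\ A_1)$, and below them stands the block diagonal matrix with $n$ diagonal blocks $A_2$. For $w,l,u\in\mathbb Z^{nt}$ and $b\in\mathbb Z^{r+ns}$ consider the $n$-fold integer program $$\min\{\,wx\ :\ A^{(n)}x=b,\ l\le x\le u,\ x\in\mathbb Z^{nt}\,\}.$$ A feasible step for a feasible point $x$ is a vector $v\in\mathbb Z^{nt}$ such that $x+v$ is feasible. The Graver basis $\mathcal G(M)$ of an integer matrix $M$ is the set of $\sqsubseteq$-minimal elements of $\{x \text{ integer}: Mx=0,\ x\ne 0\}$, where $x\sqsubseteq y$ means $x_iy_i\ge 0$ and $|x_i|\le|y_i|$ for all $i$. Then there is an algorithm, depending only on $A$, which, given any $n\ge1$, any $w,b,l,u$ and any feasible point $x$, finds a positive integer $\gamma$ and a vector $g\in\mathbb Z^{nt}$ such that $\gamma g$ is a feasible step for $x$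 and $$w(x+\gamma g)\ \le\ w(x+\bar\gamma\bar g)$$ for every nonnegative integer $\bar\gamma$ and every $\bar g\in\mathcal G(A^{(n)})$ such that $\bar\gamma\bar g$ is a feasible step for $x$. It takes quadratic time $O(n^2)$, with a constant depending only on $A$. Here time is the number of arithmetic operations on integers (additions, subtractions, multiplications, divisions with rounding), comparisons and memory accesses of a random access program, at unit cost; moreover all numbers that the algorithm handles have binary length bounded by a polynomial, depending only on $A$, in the binary length of the input $n,w,b,l,u$. -/

import Mathlib

namespace NFold

/-! ### Bimatrices, n-fold products, Graver bases -/

/-- An integer `(r,s) × t` bimatrix: a first block `A₁` of size `r × t` and a second block `A₂`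
of size `s × t`. -/
structure Bimatrix (r s t : ℕ) where
  fst : Matrix (Fin r) (Fin t) ℤ
  snd : Matrix (Fin s) (Fin t) ℤ

/-- Row indices of the `n`-fold product: `r` common rows, then `n` groups of `s` rows. -/
abbrev Row (r s n : ℕ) : Type := Fin r ⊕ (Fin n × Fin s)

/-- Column indices of the `n`-fold product: `(i, j)` is coordinate `j` of brick `i`. -/
abbrev Col (t n : ℕ) : Type := Fin n × Fin t

/-- The `n`-fold product `A^{(n)}`: the first `r` rows are `(A₁ A₁ ⋯ A₁)`, below them is the
block diagonal matrix with `n` copies of `A₂`. -/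
def Bimatrix.nFold {r s t : ℕ} (A : Bimatrix r s t) (n : ℕ) : Matrix (Row r s n) (Col t n) ℤ :=
  fun row col =>
    match row with
    | Sum.inl a => A.fst a col.2
    | Sum.inr (i, c) => if i = col.1 then A.snd c col.2 else 0

/-- The partial order `x ⊑ y`: `x` and `y` lie in a common orthant and `|x| ≤ |y|`
coordinatewise. -/
def ConformalLE {ι : Type*} (x y : ι → ℤ) : Prop :=
  ∀ i, 0 ≤ x i * y i ∧ |x i| ≤ |y i|

/-- The Graver basis of an integer matrix: the `⊑`-minimal elements among its nonzero integer
kernel vectors. -/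
def graverBasis {κ ι : Type*} [Fintype ι] (M : Matrix κ ι ℤ) : Set (ι → ℤ) :=
  {x | M.mulVec x = 0 ∧ x ≠ 0 ∧
    ∀ y : ι → ℤ, M.mulVec y = 0 → y ≠ 0 → ConformalLE y x → y = x}

/-- Feasibility of an integer point in `min {w x : M x = b, l ≤ x ≤ u}`. -/
def Feasible {κ ι : Type*} [Fintype ι] (M : Matrix κ ι ℤ) (b : κ → ℤ) (l u x : ι → ℤ) : Prop :=
  M.mulVec x = b ∧ l ≤ x ∧ x ≤ u

/-- A feasible step `v` for `x`: `x + v` is feasible again. -/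
def FeasibleStep {κ ι : Type*} [Fintype ι] (M : Matrix κ ι ℤ) (b : κ → ℤ) (l u x v : ι → ℤ) :
    Prop :=
  Feasible M b l u (x + v)

/-- Binary length of an integer: sign bit and the bits of its absolute value. -/
def bitLength (z : ℤ) : ℕ := Nat.size z.natAbs + 1

/-- Binary length of an integer vector. -/
def vecLength {ι : Type*} [Fintype ι] (v : ι → ℤ) : ℕ := ∑ i, bitLength (v i)

/-! ### The machine model: integer random access programs with unit cost operations -/

/-- Memory: integer registers, and integer arrays that are accessed by a computed index. -/
structure State where
  reg : ℕ → ℤ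
  arr : ℕ → ℤ → ℤ

/-- Arithmetic operations; `div` is the rounded quotient. -/
inductive Op where
  | add
  | sub
  | mul
  | div

/-- For a positive divisor, `div` is the floor of the quotient; the quotient by zero is `0`. -/
def Op.eval : Op → ℤ → ℤ → ℤ
  | Op.add, x, y => x + y
  | Op.sub, x, y => x - y
  | Op.mul, x, y => x * y
  | Op.div, x, y => x / y

/-- Expressions: constants of the program, registers, array cells, and arithmetic. -/
inductive Expr where
  | const (z : ℤ)
  | reg (k : ℕ)
  | cell (a : ℕ) (index : Expr)
  | op (o : Op) (e₁ e₂ : Expr)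

def Expr.eval (σ : State) : Expr → ℤ
  | Expr.const z => z
  | Expr.reg k => σ.reg k
  | Expr.cell a e => σ.arr a (e.eval σ)
  | Expr.op o e₁ e₂ => o.eval (e₁.eval σ) (e₂.eval σ)

/-- Each constant, register access, array access and arithmetic operation costs one step. -/
def Expr.cost : Expr → ℕ
  | Expr.const _ => 1
  | Expr.reg _ => 1
  | Expr.cell _ e => e.cost + 1
  | Expr.op _ e₁ e₂ => e₁.cost + e₂.cost + 1

/-- All numbers that occur in the evaluation have absolute value at most `B`. -/
def Expr.Fits (B : ℤ) (σ : State) : Expr → Prop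
  | Expr.const z => |z| ≤ B
  | Expr.reg k => |σ.reg k| ≤ B
  | Expr.cell a e => e.Fits B σ ∧ |σ.arr a (e.eval σ)| ≤ B
  | Expr.op o e₁ e₂ => e₁.Fits B σ ∧ e₂.Fits B σ ∧ |o.eval (e₁.eval σ) (e₂.eval σ)| ≤ B

/-- Comparisons. -/
inductive Test where
  | le (e₁ e₂ : Expr)
  | eq (e₁ e₂ : Expr)

def Test.Holds (σ : State) : Test → Prop
  | Test.le e₁ e₂ => e₁.eval σ ≤ e₂.eval σ
  | Test.eq e₁ e₂ => e₁.eval σ = e₂.eval σ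

def Test.cost : Test → ℕ
  | Test.le e₁ e₂ => e₁.cost + e₂.cost + 1
  | Test.eq e₁ e₂ => e₁.cost + e₂.cost + 1

def Test.Fits (B : ℤ) (σ : State) : Test → Prop
  | Test.le e₁ e₂ => e₁.Fits B σ ∧ e₂.Fits B σ
  | Test.eq e₁ e₂ => e₁.Fits B σ ∧ e₂.Fits B σ

/-- Programs. -/
inductive Prog where
  | skip
  | assign (k : ℕ) (e : Expr)
  | store (a : ℕ) (index e : Expr)
  | seq (p q : Prog)
  | ite (c : Test) (p q : Prog)
  | loop (c : Test) (p : Prog)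

def State.setReg (σ : State) (k : ℕ) (z : ℤ) : State :=
  { σ with reg := Function.update σ.reg k z }

def State.setCell (σ : State) (a : ℕ) (i z : ℤ) : State :=
  { σ with arr := Function.update σ.arr a (Function.update (σ.arr a) i z) }

/-- `Exec B p σ m τ`: started in memory `σ`, the program `p` halts in memory `τ` after `m` steps,
and all numbers that it handles have absolute value at most `B`. The constructor names ending in
`true` and `false` refer to the outcome of the comparison; `loop c p` repeats `p` while `c`
holds. -/
inductive Exec (B : ℤ) : Prog → State → ℕ → State → Prop where
  | skip (σ : State) : Exec B Prog.skip σ 1 σ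
  | assign (σ : State) (k : ℕ) (e : Expr) (he : e.Fits B σ) :
      Exec B (Prog.assign k e) σ (e.cost + 1) (σ.setReg k (e.eval σ))
  | store (σ : State) (a : ℕ) (i e : Expr) (hi : i.Fits B σ) (he : e.Fits B σ) :
      Exec B (Prog.store a i e) σ (i.cost + e.cost + 1) (σ.setCell a (i.eval σ) (e.eval σ))
  | seq {p q : Prog} {σ τ υ : State} {m m' : ℕ} (hp : Exec B p σ m τ) (hq : Exec B q τ m' υ) :
      Exec B (Prog.seq p q) σ (m + m') υ
  | ite_true {c : Test} {p q : Prog} {σ τ : State} {m : ℕ} (hf : c.Fits B σ) (hc : c.Holds σ)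
      (hp : Exec B p σ m τ) : Exec B (Prog.ite c p q) σ (c.cost + m) τ
  | ite_false {c : Test} {p q : Prog} {σ τ : State} {m : ℕ} (hf : c.Fits B σ) (hc : ¬ c.Holds σ)
      (hq : Exec B q σ m τ) : Exec B (Prog.ite c p q) σ (c.cost + m) τ
  | loop_true {c : Test} {p : Prog} {σ τ υ : State} {m m' : ℕ} (hf : c.Fits B σ)
      (hc : c.Holds σ) (hp : Exec B p σ m τ) (hl : Exec B (Prog.loop c p) τ m' υ) :
      Exec B (Prog.loop c p) σ (c.cost + m + m') υ
  | loop_false {c : Test} {p : Prog} {σ : State} (hf : c.Fits B σ) (hc : ¬ c.Holds σ) :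
      Exec B (Prog.loop c p) σ c.cost σ

/-! ### Input and output conventions -/

/-- Position, in an array, of coordinate `j` of brick `i` of a vector in `ℤ^{nt}`. -/
def colAddr {t n : ℕ} (p : Col t n) : ℤ := (p.1 : ℤ) * t + p.2

/-- Position, in an array, of an entry of a right hand side in `ℤ^{r+ns}`. -/
def rowAddr {r s n : ℕ} : Row r s n → ℤ
  | Sum.inl a => a
  | Sum.inr (i, c) => r + ((i : ℤ) * s + c)

/-- Initial memory: register `0` holds `n`; arrays `0`, `1`, `2`, `3`, `4` hold `w`, `b`, `l`, `u`,
`x`; everything else is `0`. -/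
noncomputable def initial {r s t n : ℕ} (w : Col t n → ℤ) (b : Row r s n → ℤ) (l u x : Col t n → ℤ) : State where
  reg := fun k => if k = 0 then n else 0
  arr := fun a =>
    match a with
    | 0 => Function.extend colAddr w 0
    | 1 => Function.extend rowAddr b 0
    | 2 => Function.extend colAddr l 0
    | 3 => Function.extend colAddr u 0
    | 4 => Function.extend colAddr x 0
    | _ => 0

/-- The step size that is read off the final memory: register `1`. -/
def outSize (τ : State) : ℤ := τ.reg 1

/-- The direction in `ℤ^{nt}` that is read off the final memory: array `5`. -/
def outDir (t n : ℕ) (τ : State) : Col t n → ℤ := fun p => τ.arr 5 (colAddr p)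

/-- Binary length of the input: `n` together with the numerical data `w, b, l, u`. -/
def inputLength {r s t n : ℕ} (w : Col t n → ℤ) (b : Row r s n → ℤ) (l u : Col t n → ℤ) : ℕ :=
  bitLength n + vecLength w + vecLength b + vecLength l + vecLength u

end NFold

namespace NFold

/-! ### The Graver bases of all `n`-fold products have bounded elements -/

/-! Two finiteness facts make the search possible in quadratic time.

First, the elements of all the Graver bases of the `n`-fold products have 1-norm at most a constant
`K` that depends only on `A`. Each brick of such an element `g` lies in the kernel of `A₂`, hence is
a conformal sum of elements of the Graver basis `H` of `A₂`, which is finite by Dickson's lemma.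
Adding up the multiplicities over all bricks gives a vector in `ℕ^H` that `A₁` sends to zero.
Minimality of `g` forces this vector to be minimal among the nonzero ones with this property: a
smaller one could be distributed back over the bricks and would give a smaller kernel vector below
`g`. Again by Dickson, only finitely many minimal vectors exist, whatever `n` is
(`exists_graverBasis_nFold_bound`).

Consequently every partial sum of bricks of `g` lies in the finite box `[-K, K]^t`. For a fixed step
size `γ`, a best direction among all kernel vectors whose bricks and partial sums stay in the box is
a shortest path in a layered graph with `n + 1` layers of constant size, since the bounds `l ≤ x + γ
g ≤ u` are local to each brick. Dynamic programming finds it in time `O(n)` (`tables_twp`,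
`walk_twp`). The direction found need not belong to the Graver basis; it suffices that the Graver
directions are among the competitors (`isPath_partialSum`).

Second, few step sizes matter. If `w g < 0`, enlarging the step only helps, and the largest step
along `g` is the rounded slack of one coordinate divided by some integer between `1` and `K`
(`exists_size`). This leaves at most `2 n t K` candidates, each costing `O(n)`. If `w g ≥ 0`, the
zero direction is already as good.

All numbers that occur are polynomial in the data with constants depending on `A`, so their lengths
are controlled by a linear polynomial in the input length. -/

theorem ConformalLE.trans {ι : Type*} {x y z : ι → ℤ} (h₁ : ConformalLE x y)
    (h₂ : ConformalLE y z) : ConformalLE x z := by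
  intro i
  refine ⟨?_, (h₁ i).2.trans (h₂ i).2⟩
  obtain ⟨hxy, hxy'⟩ := h₁ i
  obtain ⟨hyz, hyz'⟩ := h₂ i
  rcases lt_trichotomy (y i) 0 with h | h | h
  · exact mul_nonneg_of_nonpos_of_nonpos (by nlinarith) (by nlinarith)
  · rw [h, abs_zero, abs_nonpos_iff] at hxy'
    simp [hxy']
  · exact mul_nonneg (by nlinarith) (by nlinarith)

/-- Removing a conformal part causes no cancellation. This gives both the descent in 1-norm and the
conformality of the remainder when a kernel vector is decomposed. -/
theorem ConformalLE.sub {ι : Type*} {x y : ι → ℤ} (h : ConformalLE x y) :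
    ConformalLE (y - x) y ∧ ∀ i, |(y - x) i| = |y i| - |x i| := by
  have key : ∀ i, 0 ≤ (y - x) i * y i ∧ |(y - x) i| = |y i| - |x i| := by
    intro i
    obtain ⟨h1, h2⟩ := h i
    rw [Pi.sub_apply]
    rcases lt_trichotomy (y i) 0 with h | h | h
    · have hx : x i ≤ 0 := by nlinarith
      rw [abs_of_neg h, abs_of_nonpos hx] at *
      rw [abs_of_nonpos (by linarith)]
      exact ⟨mul_nonneg_of_nonpos_of_nonpos (by linarith) h.le, by ring⟩
    · rw [h, abs_zero, abs_nonpos_iff] at h2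
      simp [h, h2]
    · have hx : 0 ≤ x i := by nlinarith
      rw [abs_of_pos h, abs_of_nonneg hx] at *
      rw [abs_of_nonneg (by linarith)]
      exact ⟨mul_nonneg (by linarith) h.le, rfl⟩
  exact ⟨fun i => ⟨(key i).1, by rw [(key i).2]; linarith [abs_nonneg (x i)]⟩, fun i => (key i).2⟩

theorem ConformalLE.eq_of_abs_eq {ι : Type*} {x y : ι → ℤ} (h : ConformalLE x y)
    (h' : ∀ i, |x i| = |y i|) : x = y := by
  have := h.sub.2
  funext i
  have h0 := this i
  rw [h' i, sub_self, abs_eq_zero, Pi.sub_apply] at h0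
  linarith

/-- Positive and negative parts of an integer vector. -/
def signParts {ι : Type*} (x : ι → ℤ) : ι ⊕ ι → ℕ :=
  Sum.elim (fun i => (x i).toNat) (fun i => (-x i).toNat)

/-- Transfers the conformal order to the product order on tuples of natural numbers, where Dickson's
lemma is available. -/
theorem conformalLE_of_signParts_le {ι : Type*} {x y : ι → ℤ} (h : signParts x ≤ signParts y) :
    ConformalLE x y := by
  intro i
  have h1 : (x i).toNat ≤ (y i).toNat := h (Sum.inl i)
  have h2 : (-x i).toNat ≤ (-y i).toNat := h (Sum.inr i)
  refine ⟨?_, ?_⟩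
  · rcases le_total 0 (x i) with h0 | h0
    · rcases h0.eq_or_lt with h0 | h0
      · simp [← h0]
      · exact mul_nonneg h0.le (by omega)
    · rcases h0.eq_or_lt with h0 | h0
      · simp [h0]
      · exact mul_nonneg_of_nonpos_of_nonpos h0.le (by omega)
  · rw [Int.abs_eq_natAbs, Int.abs_eq_natAbs]
    omega

theorem signParts_injective {ι : Type*} : Function.Injective (signParts (ι := ι)) := by
  intro x y h
  funext i
  have h1 : (x i).toNat = (y i).toNat := congrFun h (Sum.inl i)
  have h2 : (-x i).toNat = (-y i).toNat := congrFun h (Sum.inr i)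
  omega

/-- The sign parts of the Graver basis form an antichain in a well-quasi-order. -/
theorem graverBasis_finite {κ ι : Type*} [Fintype ι] (M : Matrix κ ι ℤ) :
    (graverBasis M).Finite := by
  refine Set.Finite.of_finite_image (f := signParts) ?_ signParts_injective.injOn
  apply WellQuasiOrderedLE.finite_of_isAntichain
  rintro _ ⟨x, hx, rfl⟩ _ ⟨y, hy, rfl⟩ hne hle
  exact hne (congrArg _ (hy.2.2 x hx.1 hx.2.1 (conformalLE_of_signParts_le hle)))

/-- Among the nonzero kernel vectors conformal to `x`, one of least 1-norm is minimal. -/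
theorem exists_graverBasis_conformalLE {κ ι : Type*} [Fintype ι] (M : Matrix κ ι ℤ) (x : ι → ℤ)
    (hx : M.mulVec x = 0) (hx0 : x ≠ 0) : ∃ h ∈ graverBasis M, ConformalLE h x := by
  let N : (ι → ℤ) → ℕ := fun y => ∑ i, (y i).natAbs
  have hex : ∃ m, ∃ y, M.mulVec y = 0 ∧ y ≠ 0 ∧ ConformalLE y x ∧ N y = m :=
    ⟨N x, x, hx, hx0, fun i => ⟨mul_self_nonneg _, le_rfl⟩, rfl⟩
  classical
  obtain ⟨y, hy, hy0, hyx, hN⟩ := Nat.find_spec hex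
  refine ⟨y, ⟨hy, hy0, fun z hz hz0 hzy => ?_⟩, hyx⟩
  have hle : N y ≤ N z := hN ▸ Nat.find_min' hex ⟨z, hz, hz0, hzy.trans hyx, rfl⟩
  refine hzy.eq_of_abs_eq fun i => ?_
  have hi : ∀ i ∈ Finset.univ, (z i).natAbs ≤ (y i).natAbs := fun i _ => by
    have := (hzy i).2
    rw [Int.abs_eq_natAbs, Int.abs_eq_natAbs] at this
    omega
  have := (Finset.sum_eq_sum_iff_of_le hi).1 (le_antisymm (Finset.sum_le_sum hi) hle) i
    (Finset.mem_univ i)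
  rw [Int.abs_eq_natAbs, Int.abs_eq_natAbs, this]

/-- Every integer kernel vector is a conformal sum of elements of the Graver basis. -/
theorem exists_conformal_sum {κ ι : Type*} [Fintype ι] (M : Matrix κ ι ℤ)
    (H : Finset (ι → ℤ)) (hH : ∀ h, h ∈ H ↔ h ∈ graverBasis M) (x : ι → ℤ)
    (hx : M.mulVec x = 0) :
    ∃ μ : H → ℕ, x = ∑ h, μ h • h.1 ∧ ∀ h, μ h ≠ 0 → ConformalLE h.1 x := by
  classical
  induction hm : ∑ i, (x i).natAbs using Nat.strong_induction_on generalizing x with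
  | _ m ih =>
    by_cases hx0 : x = 0
    · exact ⟨0, by simp [hx0], by simp⟩
    obtain ⟨h, hh, hhx⟩ := exists_graverBasis_conformalLE M x hx hx0
    obtain ⟨hsub, habs⟩ := hhx.sub
    -- The induction is on the 1-norm: it drops by the 1-norm of `h`, which is positive as `h ≠ 0`.
    have hlt : ∑ i, ((x - h) i).natAbs < m := by
      rw [← hm]
      obtain ⟨j, hj⟩ := Function.ne_iff.1 hh.2.1
      rw [Pi.zero_apply] at hj
      have hi : ∀ i, (((x - h) i).natAbs : ℤ) = (x i).natAbs - (h i).natAbs := fun i => by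
        have := habs i
        simpa only [Int.abs_eq_natAbs] using this
      refine Finset.sum_lt_sum (fun i _ => ?_) ⟨j, Finset.mem_univ j, ?_⟩
      · have := hi i
        omega
      · have := hi j
        omega
    obtain ⟨μ, hμ, hμ'⟩ := ih _ hlt (x - h)
      (by rw [Matrix.mulVec_sub, hx, hh.1, sub_zero]) rfl
    refine ⟨μ + Pi.single ⟨h, (hH h).2 hh⟩ 1, ?_, fun k hk => ?_⟩
    · simp only [Pi.add_apply, add_smul, Finset.sum_add_distrib]
      rw [← hμ, Finset.sum_eq_single ⟨h, (hH h).2 hh⟩]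
      · simp
      · intro b _ hb
        simp [Pi.single_eq_of_ne hb]
      · simp
    · by_cases hkh : k = ⟨h, (hH h).2 hh⟩
      · rw [hkh]
        exact hhx
      · rw [Pi.add_apply, Pi.single_eq_of_ne hkh, add_zero] at hk
        exact (hμ' k hk).trans hsub

/-- The summands that occur lie in the orthant of `x`, so absolute values add up. Smaller
multiplicities `ν ≤ μ` are allowed because parts of a decomposition have to be compared with the
whole. -/
theorem abs_sum_nsmul_of_conformalLE {ι : Type*} {H : Finset (ι → ℤ)} {μ ν : H → ℕ} {x : ι → ℤ}
    (hμ : ∀ h, μ h ≠ 0 → ConformalLE h.1 x) (hν : ν ≤ μ) (i : ι) :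
    |(∑ h, ν h • h.1) i| = ∑ h, (ν h : ℤ) * |h.1 i| ∧ 0 ≤ (∑ h, ν h • h.1) i * x i := by
  have hne : ∀ h, ν h ≠ 0 → ConformalLE h.1 x := fun h hh =>
    hμ h fun h0 => hh (Nat.le_zero.1 (h0 ▸ hν h))
  rw [Finset.sum_apply]
  simp only [Pi.smul_apply, nsmul_eq_mul]
  rcases le_or_gt 0 (x i) with hx | hx
  · have hs : ∀ h : H, (ν h : ℤ) * h.1 i = ν h * |h.1 i| := by
      intro h
      by_cases h0 : ν h = 0
      · simp [h0]
      obtain ⟨h1, h2⟩ := hne h h0 i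
      rcases hx.eq_or_lt with hx | hx
      · rw [← hx, abs_zero, abs_nonpos_iff] at h2
        simp [h2]
      · rw [abs_of_nonneg (by nlinarith)]
    simp only [hs]
    have h0 : 0 ≤ ∑ h, (ν h : ℤ) * |h.1 i| :=
      Finset.sum_nonneg fun h _ => mul_nonneg (Nat.cast_nonneg _) (abs_nonneg _)
    exact ⟨abs_of_nonneg h0, mul_nonneg h0 hx⟩
  · have hs : ∀ h : H, (ν h : ℤ) * h.1 i = -(ν h * |h.1 i|) := by
      intro h
      by_cases h0 : ν h = 0
      · simp [h0]
      obtain ⟨h1, h2⟩ := hne h h0 i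
      rw [abs_of_nonpos (by nlinarith)]
      ring
    simp only [hs, Finset.sum_neg_distrib, abs_neg]
    have h0 : 0 ≤ ∑ h, (ν h : ℤ) * |h.1 i| :=
      Finset.sum_nonneg fun h _ => mul_nonneg (Nat.cast_nonneg _) (abs_nonneg _)
    exact ⟨abs_of_nonneg h0, mul_nonneg_of_nonpos_of_nonpos (by linarith) hx.le⟩

/-- Used to distribute a smaller total multiplicity over the bricks without exceeding the
multiplicity in any brick. -/
theorem exists_le_sum_eq {ι : Type*} (s : Finset ι) (m : ι → ℕ) (c : ℕ) (hc : c ≤ ∑ i ∈ s, m i) :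
    ∃ m' ≤ m, ∑ i ∈ s, m' i = c := by
  classical
  induction s using Finset.induction_on generalizing c with
  | empty => exact ⟨0, fun _ => Nat.zero_le _, by simp at hc; simp [hc]⟩
  | insert a s ha ih =>
    rw [Finset.sum_insert ha] at hc
    obtain ⟨m', hm', hs⟩ := ih (c - min c (m a)) (by omega)
    refine ⟨Function.update m' a (min c (m a)), fun i => ?_, ?_⟩
    · by_cases h : i = a
      · subst h
        simp
      · rw [Function.update_of_ne h]
        exact hm' i
    · rw [Finset.sum_insert ha, Function.update_self, Finset.sum_congr rfl, hs]
      · omega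
      · intro i hi
        rw [Function.update_of_ne]
        rintro rfl
        exact ha hi

theorem nFold_mulVec_eq_iff {r s t n : ℕ} (A : Bimatrix r s t) (g : Col t n → ℤ)
    (b : Row r s n → ℤ) :
    (A.nFold n).mulVec g = b ↔
      A.fst.mulVec (∑ i, fun j => g (i, j)) = (fun a => b (Sum.inl a)) ∧
        ∀ i, A.snd.mulVec (fun j => g (i, j)) = fun c => b (Sum.inr (i, c)) := by
  have h1 : ∀ a, (A.nFold n).mulVec g (Sum.inl a) =
      A.fst.mulVec (∑ i, fun j => g (i, j)) a := by
    intro a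
    simp only [Matrix.mulVec, dotProduct, Bimatrix.nFold, Finset.sum_apply, Finset.mul_sum]
    rw [Fintype.sum_prod_type, Finset.sum_comm]
  have h2 : ∀ i c, (A.nFold n).mulVec g (Sum.inr (i, c)) =
      A.snd.mulVec (fun j => g (i, j)) c := by
    intro i c
    simp only [Matrix.mulVec, dotProduct, Bimatrix.nFold]
    rw [Fintype.sum_prod_type, Finset.sum_eq_single i]
    · simp
    · intro k _ hk
      simp [hk.symm]
    · simp
  constructor
  · rintro rfl
    exact ⟨funext fun a => (h1 a).symm, fun i => funext fun c => (h2 i c).symm⟩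
  · rintro ⟨h, h'⟩
    funext p
    rcases p with a | ⟨i, c⟩
    · rw [h1, h]
    · rw [h2, h']

/-- The elements of the Graver bases of all `n`-fold products of a bimatrix have bounded norm. -/
theorem exists_graverBasis_nFold_bound {r s t : ℕ} (A : Bimatrix r s t) :
    ∃ K : ℕ, ∀ n, ∀ g ∈ graverBasis (A.nFold n), ∑ p, |g p| ≤ K := by
  classical
  set H : Finset (Fin t → ℤ) := (graverBasis_finite A.snd).toFinset
  have hH : ∀ h, h ∈ H ↔ h ∈ graverBasis A.snd := fun h => by simp [H]
  let S : Set (H → ℕ) := {c | A.fst.mulVec (∑ h, c h • h.1) = 0 ∧ c ≠ 0}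
  -- `S` does not involve `n`; this is what makes the bound uniform.
  have hfin : {c | Minimal (· ∈ S) c}.Finite :=
    WellQuasiOrderedLE.finite_of_isAntichain (setOfPred_minimal_antichain _)
  let N : (H → ℕ) → ℤ := fun c => ∑ h, c h * ∑ j, |h.1 j|
  obtain ⟨K, hK⟩ := (hfin.image fun c => (N c).toNat).bddAbove
  refine ⟨K, fun n g hg => ?_⟩
  obtain ⟨hg1, hg2⟩ := (nFold_mulVec_eq_iff A g 0).1 hg.1
  choose μ hμ hμ' using fun i => exists_conformal_sum A.snd H hH (fun j => g (i, j)) (hg2 i)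
  have hsum : ∀ ν : Fin n → H → ℕ, ∑ i, ∑ h, ν i h • h.1 = ∑ h, (∑ i, ν i) h • h.1 := by
    intro ν
    rw [Finset.sum_comm]
    simp only [Finset.sum_apply, Finset.sum_smul]
  have habs : ∀ ν : Fin n → H → ℕ, ν ≤ μ →
      ∑ p : Col t n, |(∑ h, ν p.1 h • h.1) p.2| = N (∑ i, ν i) := by
    intro ν hν
    have : ∀ i j, |(∑ h, ν i h • h.1) j| = ∑ h, (ν i h : ℤ) * |h.1 j| :=
      fun i j => (abs_sum_nsmul_of_conformalLE (hμ' i) (hν i) j).1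
    rw [Fintype.sum_prod_type]
    simp only [this]
    simp only [N, Finset.sum_apply, Nat.cast_sum, Finset.sum_mul, Finset.mul_sum]
    refine Eq.trans (b := ∑ i, ∑ h : H, ∑ j, (ν i h : ℤ) * |h.1 j|)
      (Finset.sum_congr rfl fun i _ => Finset.sum_comm) ?_
    rw [Finset.sum_comm]
    exact Finset.sum_congr rfl fun h _ => Finset.sum_comm
  -- A smaller element `c` of `S` is split among the bricks as `ν ≤ μ`. The vector `g'` with these
  -- multiplicities is a nonzero kernel vector conformal to `g`, hence equal to `g`, and comparing
  -- norms gives `c = ∑ i, μ i`.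
  have hmin : Minimal (· ∈ S) (∑ i, μ i) := by
    refine ⟨⟨?_, ?_⟩, ?_⟩
    · rw [← hsum]
      simp only [← hμ]
      exact hg1
    · intro h0
      apply hg.2.1
      funext ⟨i, j⟩
      have : μ i = 0 := by
        funext h
        have := congrFun h0 h
        rw [Finset.sum_apply] at this
        exact Finset.sum_eq_zero_iff.1 this i (Finset.mem_univ i)
      have := congrFun (hμ i) j
      simp_all
    · rintro c ⟨hc, hc0⟩ hle
      have : ∀ h, ∃ m' ≤ fun i => μ i h, ∑ i, m' i = c h := fun h =>
        exists_le_sum_eq Finset.univ (fun i => μ i h) (c h) (by simpa using hle h)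
      choose m hm hmc using this
      let ν : Fin n → H → ℕ := fun i h => m h i
      have hν : ν ≤ μ := fun i h => hm h i
      have hνc : ∑ i, ν i = c := by
        funext h
        rw [Finset.sum_apply]
        exact hmc h
      let g' : Col t n → ℤ := fun p => (∑ h, ν p.1 h • h.1) p.2
      have hconf : ConformalLE g' g := by
        rintro ⟨i, j⟩
        refine ⟨(abs_sum_nsmul_of_conformalLE (hμ' i) (hν i) j).2, ?_⟩
        have h1 := (abs_sum_nsmul_of_conformalLE (hμ' i) (hν i) j).1
        have h2 := (abs_sum_nsmul_of_conformalLE (hμ' i) le_rfl j).1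
        rw [← hμ i] at h2
        change |(∑ h, ν i h • h.1) j| ≤ |g (i, j)|
        rw [h1, h2]
        exact Finset.sum_le_sum fun h _ => mul_le_mul_of_nonneg_right
          (by exact_mod_cast hν i h) (abs_nonneg _)
      have hker : (A.nFold n).mulVec g' = 0 := by
        rw [nFold_mulVec_eq_iff]
        refine ⟨?_, fun i => ?_⟩
        · change A.fst.mulVec (∑ i, ∑ h, ν i h • h.1) = 0
          rw [hsum, hνc, hc]
        · change A.snd.mulVec (∑ h, ν i h • h.1) = 0
          rw [Matrix.mulVec_sum]
          refine Finset.sum_eq_zero fun h _ => ?_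
          rw [Matrix.mulVec_smul, ((hH h.1).1 h.2).1, smul_zero]
      -- `N` weights each multiplicity with the norm of a nonzero vector, so it detects zero. It is
      -- used both for `g' ≠ 0` and for the vanishing of the difference of multiplicities.
      have hNpos : ∀ c : H → ℕ, N c = 0 → c = 0 := by
        intro c hN
        have hnn : ∀ h : H, 0 ≤ ∑ j, |h.1 j| := fun h => Finset.sum_nonneg fun _ _ => abs_nonneg _
        have h0 := (Finset.sum_eq_zero_iff_of_nonneg
          (fun h _ => mul_nonneg (Nat.cast_nonneg (c h)) (hnn h))).1 hN
        funext h
        rcases mul_eq_zero.1 (h0 h (Finset.mem_univ h)) with h1 | h1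
        · exact_mod_cast h1
        · exfalso
          apply ((hH h.1).1 h.2).2.1
          funext j
          have := (Finset.sum_eq_zero_iff_of_nonneg (fun j _ => abs_nonneg (h.1 j))).1 h1 j
            (Finset.mem_univ j)
          simpa using this
      have hN' := habs ν hν
      rw [hνc] at hN'
      have hg' : g' ≠ 0 := by
        intro h0
        apply hc0
        apply hNpos
        rw [← hN']
        change ∑ p, |g' p| = 0
        simp [h0]
      have heq := hg.2.2 g' hker hg' hconf
      have hNg := habs μ le_rfl
      have hNeq : N (∑ i, μ i) = N c := by
        rw [← hN', ← hNg]
        refine Finset.sum_congr rfl ?_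
        rintro ⟨i, j⟩ _
        change |(∑ h, μ i h • h.1) j| = |g' (i, j)|
        rw [heq, ← hμ i]
      have hd : N (∑ i, μ i - c) = 0 := by
        have : N (∑ i, μ i - c) = N (∑ i, μ i) - N c := by
          simp only [N, ← Finset.sum_sub_distrib]
          refine Finset.sum_congr rfl fun h _ => ?_
          rw [Pi.sub_apply, Nat.cast_sub (hle h), sub_mul]
        rw [this, hNeq, sub_self]
      exact tsub_eq_zero_iff_le.1 (hNpos _ hd)
  have hgN : ∑ p, |g p| = N (∑ i, μ i) := by
    rw [← habs μ le_rfl]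
    refine Finset.sum_congr rfl ?_
    rintro ⟨i, j⟩ _
    change |g (i, j)| = |(∑ h, μ i h • h.1) j|
    rw [← hμ i]
  rw [hgN]
  have := hK ⟨_, hmin, rfl⟩
  have h2 := Int.self_le_toNat (N (∑ i, μ i))
  simp only at this
  omega

end NFold

namespace NFold

/-! ### Reasoning about executions -/

/-- The program `p`, started in `s`, halts in a memory that satisfies `Q`. -/
def WP (B : ℤ) (p : Prog) (s : State) (Q : State → Prop) : Prop :=
  ∃ m τ, Exec B p s m τ ∧ Q τ

/-- The program `p`, started in `s`, halts after at most `c` steps in a memory that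
satisfies `Q`. -/
def TWP (B : ℤ) (p : Prog) (s : State) (c : ℕ) (Q : State → Prop) : Prop :=
  ∃ m τ, Exec B p s m τ ∧ m ≤ c ∧ Q τ

/-- Programs without loops. -/
def Prog.LoopFree : Prog → Prop
  | Prog.seq p q => p.LoopFree ∧ q.LoopFree
  | Prog.ite _ p q => p.LoopFree ∧ q.LoopFree
  | Prog.loop _ _ => False
  | _ => True

/-- A bound on the number of steps of a program without loops. -/
def Prog.cost : Prog → ℕ
  | Prog.skip => 1
  | Prog.assign _ e => e.cost + 1
  | Prog.store _ i e => i.cost + e.cost + 1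
  | Prog.seq p q => p.cost + q.cost
  | Prog.ite c p q => c.cost + (p.cost + q.cost)
  | Prog.loop _ _ => 0

/-- Lets correctness of loop-free code be proved without counting steps: its running time is a
constant of the program, so only loops need explicit accounting. -/
theorem Exec.le_cost {B : ℤ} {p : Prog} {s τ : State} {m : ℕ} (h : Exec B p s m τ)
    (hp : p.LoopFree) : m ≤ p.cost := by
  induction h with
  | skip => exact le_rfl
  | assign => exact le_rfl
  | store => exact le_rfl
  | seq _ _ ih₁ ih₂ => exact add_le_add (ih₁ hp.1) (ih₂ hp.2)
  | ite_true _ _ _ ih =>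
    have := ih hp.1
    simp only [Prog.cost]
    omega
  | ite_false _ _ _ ih =>
    have := ih hp.2
    simp only [Prog.cost]
    omega
  | loop_true => exact hp.elim
  | loop_false => exact hp.elim

variable {B : ℤ} {p q : Prog} {s : State} {Q R : State → Prop}

theorem WP.timed (h : WP B p s Q) (hp : p.LoopFree) : TWP B p s p.cost Q :=
  let ⟨m, τ, he, hQ⟩ := h
  ⟨m, τ, he, he.le_cost hp, hQ⟩

theorem WP.mono (h : WP B p s Q) (hQR : ∀ τ, Q τ → R τ) : WP B p s R :=
  let ⟨m, τ, he, hQ⟩ := h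
  ⟨m, τ, he, hQR τ hQ⟩

theorem TWP.mono {c c' : ℕ} (h : TWP B p s c Q) (hc : c ≤ c') (hQR : ∀ τ, Q τ → R τ) :
    TWP B p s c' R :=
  let ⟨m, τ, he, hm, hQ⟩ := h
  ⟨m, τ, he, hm.trans hc, hQR τ hQ⟩

theorem WP.skip (h : Q s) : WP B Prog.skip s Q := ⟨1, s, Exec.skip s, h⟩

theorem TWP.skip (h : Q s) : TWP B Prog.skip s 1 Q := ⟨1, s, Exec.skip s, le_rfl, h⟩

theorem WP.assign {k : ℕ} {e : Expr} (he : e.Fits B s) (h : Q (s.setReg k (e.eval s))) :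
    WP B (Prog.assign k e) s Q := ⟨_, _, Exec.assign s k e he, h⟩

theorem TWP.assign {k : ℕ} {e : Expr} (he : e.Fits B s) (h : Q (s.setReg k (e.eval s))) :
    TWP B (Prog.assign k e) s (e.cost + 1) Q := ⟨_, _, Exec.assign s k e he, le_rfl, h⟩

theorem WP.store {a : ℕ} {i e : Expr} (hi : i.Fits B s) (he : e.Fits B s)
    (h : Q (s.setCell a (i.eval s) (e.eval s))) : WP B (Prog.store a i e) s Q :=
  ⟨_, _, Exec.store s a i e hi he, h⟩

theorem WP.seq (hp : WP B p s fun τ => WP B q τ Q) : WP B (Prog.seq p q) s Q :=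
  let ⟨_, _, h₁, _, τ, h₂, hQ⟩ := hp
  ⟨_, τ, Exec.seq h₁ h₂, hQ⟩

theorem TWP.seq {c c' : ℕ} (hp : TWP B p s c fun τ => TWP B q τ c' Q) :
    TWP B (Prog.seq p q) s (c + c') Q :=
  let ⟨_, _, h₁, hc, _, τ, h₂, hc', hQ⟩ := hp
  ⟨_, τ, Exec.seq h₁ h₂, add_le_add hc hc', hQ⟩

theorem WP.ite {c : Test} (hf : c.Fits B s) (hp : c.Holds s → WP B p s Q)
    (hq : ¬ c.Holds s → WP B q s Q) : WP B (Prog.ite c p q) s Q := by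
  by_cases hc : c.Holds s
  · obtain ⟨m, τ, he, hQ⟩ := hp hc
    exact ⟨_, τ, Exec.ite_true hf hc he, hQ⟩
  · obtain ⟨m, τ, he, hQ⟩ := hq hc
    exact ⟨_, τ, Exec.ite_false hf hc he, hQ⟩

theorem TWP.ite {c : Test} {k k' : ℕ} (hf : c.Fits B s) (hp : c.Holds s → TWP B p s k Q)
    (hq : ¬ c.Holds s → TWP B q s k' Q) : TWP B (Prog.ite c p q) s (c.cost + (k + k')) Q := by
  by_cases hc : c.Holds s
  · obtain ⟨m, τ, he, hm, hQ⟩ := hp hc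
    exact ⟨_, τ, Exec.ite_true hf hc he, by omega, hQ⟩
  · obtain ⟨m, τ, he, hm, hQ⟩ := hq hc
    exact ⟨_, τ, Exec.ite_false hf hc he, by omega, hQ⟩

/-- A loop whose invariant `I k` counts the remaining rounds `k`. -/
theorem TWP.loop {c : Test} {k : ℕ} (I : ℕ → State → Prop)
    (hf : ∀ m τ, I m τ → c.Fits B τ) (hc : ∀ m τ, I m τ → (c.Holds τ ↔ m ≠ 0))
    (hp : ∀ m τ, I (m + 1) τ → TWP B p τ k (I m)) (n : ℕ) (hI : I n s) :
    TWP B (Prog.loop c p) s (n * (c.cost + k) + c.cost) (I 0) := by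
  induction n generalizing s with
  | zero =>
    exact ⟨_, s, Exec.loop_false (hf 0 s hI) (by simp [hc 0 s hI]), by omega, hI⟩
  | succ n ih =>
    obtain ⟨m, τ, he, hm, hτ⟩ := hp n s hI
    obtain ⟨m', υ, he', hm', hυ⟩ := ih hτ
    refine ⟨_, υ, Exec.loop_true (hf _ s hI) ((hc _ s hI).2 (Nat.succ_ne_zero n)) he he', ?_, hυ⟩
    rw [Nat.succ_mul]
    omega

/-- The programs `f a` in sequence, for the entries `a` of a list. -/
def forEach {α : Type*} (l : List α) (f : α → Prog) : Prog :=
  l.foldr (fun a p => Prog.seq (f a) p) Prog.skip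

theorem forEach_loopFree {α : Type*} {l : List α} {f : α → Prog}
    (h : ∀ a, (f a).LoopFree) : (forEach l f).LoopFree := by
  induction l with
  | nil => trivial
  | cons a l ih => exact ⟨h a, ih⟩

/-- The invariant depends on the list of the entries that have been processed. -/
theorem WP.forEach {α : Type*} {l : List α} {f : α → Prog} (I : List α → State → Prop)
    (h : ∀ pre, ∀ a ∈ l, ∀ τ, I pre τ → WP B (f a) τ (I (a :: pre))) (pre : List α)
    (hI : I pre s) : WP B (forEach l f) s (I (l.reverse ++ pre)) := by
  induction l generalizing s pre with
  | nil => exact WP.skip hI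
  | cons a l ih =>
    refine WP.seq ((h pre a (by simp) s hI).mono fun τ hτ => ?_)
    have := ih (fun pre b hb => h pre b (by simp [hb])) (a :: pre) hτ
    rw [List.reverse_cons, List.append_assoc]
    exact this

theorem TWP.forEach {α : Type*} {l : List α} {f : α → Prog} {c : ℕ} (I : List α → State → Prop)
    (h : ∀ pre, ∀ a ∈ l, ∀ τ, I pre τ → TWP B (f a) τ c (I (a :: pre))) (pre : List α)
    (hI : I pre s) : TWP B (forEach l f) s (l.length * c + 1) (I (l.reverse ++ pre)) := by
  induction l generalizing s pre with
  | nil => exact (TWP.skip hI).mono (by simp) fun _ => id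
  | cons a l ih =>
    refine TWP.mono (c := c + (l.length * c + 1)) (TWP.seq ((h pre a (by simp) s hI).mono le_rfl
      fun τ hτ => ih (fun pre b hb => h pre b (by simp [hb])) (a :: pre) hτ)) ?_ ?_
    · rw [List.length_cons, Nat.succ_mul]
      omega
    · simp

/-- A sequence of programs of which each establishes its own fact and preserves the facts
established by the others. -/
theorem WP.forEach_and {α : Type*} {l : List α} {f : α → Prog} (I : State → Prop)
    (F : α → State → Prop)
    (h : ∀ a ∈ l, ∀ τ, I τ → WP B (f a) τ fun υ =>
      I υ ∧ F a υ ∧ ∀ b ∈ l, b ≠ a → F b τ → F b υ)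
    (hI : I s) : WP B (NFold.forEach l f) s fun τ => I τ ∧ ∀ a ∈ l, F a τ := by
  refine (WP.forEach (fun pre τ => I τ ∧ ∀ a ∈ l, a ∈ pre → F a τ) ?_ []
    ⟨hI, by simp⟩).mono fun τ hτ => ⟨hτ.1, fun a ha => hτ.2 a ha (by simp [ha])⟩
  rintro pre a ha τ ⟨hI, hF⟩
  refine (h a ha τ hI).mono fun υ hυ => ⟨hυ.1, fun b hb hbp => ?_⟩
  by_cases hba : b = a
  · exact hba ▸ hυ.2.1
  · exact hυ.2.2 b hb hba (hF b hb ((List.mem_cons.1 hbp).resolve_left hba))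

/-- Runs `p` if all the tests succeed. -/
def guarded (cs : List Test) (p : Prog) : Prog :=
  cs.foldr (fun c q => Prog.ite c q Prog.skip) p

theorem guarded_loopFree {cs : List Test} (h : p.LoopFree) : (guarded cs p).LoopFree := by
  induction cs with
  | nil => exact h
  | cons c cs ih => exact ⟨ih, trivial⟩

theorem WP.guarded {cs : List Test} (hf : ∀ c ∈ cs, c.Fits B s)
    (hp : (∀ c ∈ cs, c.Holds s) → WP B p s Q) (hs : (¬ ∀ c ∈ cs, c.Holds s) → Q s) :
    WP B (guarded cs p) s Q := by
  induction cs with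
  | nil => exact hp (by simp)
  | cons c cs ih =>
    refine WP.ite (hf c (by simp)) (fun hc => ?_) fun hc => WP.skip (hs fun h => hc (h c (by simp)))
    refine ih (fun c hc => hf c (by simp [hc])) (fun h => hp ?_) fun h => hs fun h' => h ?_
    · simpa [hc] using h
    · exact fun c hc => h' c (by simp [hc])

/-- Runs `f a` for the first entry `a` of the list whose test succeeds. -/
def switch {α : Type*} (l : List α) (c : α → Test) (f : α → Prog) : Prog :=
  l.foldr (fun a p => Prog.ite (c a) (f a) p) Prog.skip

theorem switch_loopFree {α : Type*} {l : List α} {c : α → Test} {f : α → Prog}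
    (h : ∀ a, (f a).LoopFree) : (switch l c f).LoopFree := by
  induction l with
  | nil => trivial
  | cons a l ih => exact ⟨h a, ih⟩

theorem WP.switch {α : Type*} {l : List α} {c : α → Test} {f : α → Prog} {a : α} (ha : a ∈ l)
    (hf : ∀ b ∈ l, (c b).Fits B s) (hc : ∀ b ∈ l, (c b).Holds s ↔ b = a)
    (h : WP B (f a) s Q) : WP B (switch l c f) s Q := by
  induction l with
  | nil => simp at ha
  | cons b l ih =>
    refine WP.ite (hf b (by simp)) (fun hb => ?_) fun hb => ?_
    · rw [(hc b (by simp)).1 hb]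
      exact h
    · refine ih ((List.mem_cons.1 ha).resolve_left fun hab => ?_)
        (fun b hb => hf b (by simp [hb])) (fun b hb => hc b (by simp [hb]))
      exact hb ((hc b (by simp)).2 hab.symm)

end NFold

namespace NFold

/-! ### Paths of partial sums and tables of optimal values -/

/-- The integer vectors with entries of absolute value at most `K`. -/
noncomputable def box (t K : ℕ) : List (Fin t → ℤ) :=
  (Fintype.piFinset fun _ => Finset.Icc (-K : ℤ) K).toList

theorem mem_box {t K : ℕ} {z : Fin t → ℤ} : z ∈ box t K ↔ ∀ j, |z j| ≤ K := by
  simp [box, Fintype.mem_piFinset, abs_le]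

theorem zero_mem_box (t K : ℕ) : 0 ∈ box t K := mem_box.2 (by simp)

/-- The bricks that may follow the partial sum `σ`. -/
noncomputable def moves {r s t : ℕ} (A : Bimatrix r s t) (K : ℕ) (σ : Fin t → ℤ) :
    List (Fin t → ℤ) :=
  (box t K).filter fun z => A.snd.mulVec z = 0 ∧ σ + z ∈ box t K

theorem mem_moves {r s t : ℕ} {A : Bimatrix r s t} {K : ℕ} {σ z : Fin t → ℤ} :
    z ∈ moves A K σ ↔ z ∈ box t K ∧ A.snd.mulVec z = 0 ∧ σ + z ∈ box t K := by
  simp [moves]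

/-- The data of an instance as they are stored in arrays, with a feasible point `x`, a bound `M`
for these data, a bound `D` for the constants of the program, and a bound `B` for all numbers. -/
structure Env (t K : ℕ) where
  n : ℕ
  w : ℤ → ℤ
  l : ℤ → ℤ
  u : ℤ → ℤ
  x : ℤ → ℤ
  M : ℤ
  D : ℤ
  B : ℤ
  one_le_M : 1 ≤ M
  one_le_D : 1 ≤ D
  n_le : (n : ℤ) ≤ M
  t_le : (t : ℤ) ≤ D
  K_le : (K : ℤ) ≤ D
  code_le : ∀ z ∈ box t K, (Encodable.encode z : ℤ) + 1 ≤ D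
  le_B : 4 * M ^ 3 * D ^ 2 ≤ B
  abs_w : ∀ i < n, ∀ j : Fin t, |w (i * t + j)| ≤ M
  abs_l : ∀ i < n, ∀ j : Fin t, |l (i * t + j)| ≤ M
  abs_u : ∀ i < n, ∀ j : Fin t, |u (i * t + j)| ≤ M
  l_le_x : ∀ i < n, ∀ j : Fin t, l (i * t + j) ≤ x (i * t + j)
  x_le_u : ∀ i < n, ∀ j : Fin t, x (i * t + j) ≤ u (i * t + j)

variable {r s t K : ℕ}

namespace Env

variable (E : Env t K)

theorem abs_x {i : ℕ} (hi : i < E.n) (j : Fin t) : |E.x (i * t + j)| ≤ E.M := by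
  have h1 := abs_le.1 (E.abs_l i hi j)
  have h2 := abs_le.1 (E.abs_u i hi j)
  have h3 := E.l_le_x i hi j
  have h4 := E.x_le_u i hi j
  exact abs_le.2 ⟨by linarith, by linarith⟩

/-- Covers addresses, loop counters and the moved coordinates `x + γ z`, which are at most `M + 2 M
D`. -/
theorem four_mul_le_B : 4 * (E.M * E.D) ≤ E.B := by
  refine le_trans ?_ E.le_B
  have hM := E.one_le_M
  have hD := E.one_le_D
  have h1 : E.M ≤ E.M ^ 3 := le_self_pow₀ hM (by norm_num)
  have h2 : E.D ≤ E.D ^ 2 := le_self_pow₀ hD (by norm_num)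
  have : E.M * E.D ≤ E.M ^ 3 * E.D ^ 2 := mul_le_mul h1 h2 (by linarith) (by positivity)
  linarith

theorem M_le_MD : E.M ≤ E.M * E.D :=
  le_mul_of_one_le_right (by linarith [E.one_le_M]) E.one_le_D

theorem D_le_MD : E.D ≤ E.M * E.D :=
  le_mul_of_one_le_left (by linarith [E.one_le_D]) E.one_le_M

theorem MD_nonneg : 0 ≤ E.M * E.D :=
  mul_nonneg (by linarith [E.one_le_M]) (by linarith [E.one_le_D])

/-- A bound for the objective value of one brick. -/
def brickBound : ℤ := t * (K * E.M)

theorem brickBound_nonneg : 0 ≤ E.brickBound :=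
  mul_nonneg (by positivity) (mul_nonneg (by positivity) (by linarith [E.one_le_M]))

/-- The largest numbers are step size times path value: the step size is at most `2 M`, there are at
most `M` bricks, and each contributes at most `D² M`. This explains the shape `M³ D²` in the bound
for `B`. -/
theorem size_mul_value_le_B : 2 * E.M * (E.n * E.brickBound) ≤ E.B := by
  have hM : 0 ≤ E.M := by linarith [E.one_le_M]
  have hD : 0 ≤ E.D := by linarith [E.one_le_D]
  have h1 : E.brickBound ≤ E.D * (E.D * E.M) :=
    mul_le_mul E.t_le (mul_le_mul_of_nonneg_right E.K_le hM)
      (mul_nonneg (by positivity) hM) hD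
  have h2 : E.n * E.brickBound ≤ E.M * (E.D * (E.D * E.M)) :=
    mul_le_mul E.n_le h1 E.brickBound_nonneg hM
  have h3 := mul_le_mul_of_nonneg_left h2 (by linarith : 0 ≤ 2 * E.M)
  refine h3.trans (le_trans ?_ E.le_B)
  have : 0 ≤ E.M ^ 3 * E.D ^ 2 := by positivity
  linarith

theorem value_le_B : E.n * E.brickBound ≤ E.B := by
  refine le_trans ?_ E.size_mul_value_le_B
  have := mul_nonneg (Nat.cast_nonneg E.n) E.brickBound_nonneg
  exact le_mul_of_one_le_left this (by linarith [E.one_le_M])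

/-- The objective value of the brick `z` at position `i`. -/
def gain (i : ℕ) (z : Fin t → ℤ) : ℤ := ∑ j : Fin t, E.w (i * t + j) * z j

theorem abs_gain_le {i : ℕ} (hi : i < E.n) {z : Fin t → ℤ} (hz : z ∈ box t K) :
    |E.gain i z| ≤ E.brickBound := by
  refine (Finset.abs_sum_le_sum_abs _ _).trans ?_
  refine (Finset.sum_le_card_nsmul _ _ (K * E.M) fun j _ => ?_).trans ?_
  · rw [abs_mul, mul_comm]
    exact mul_le_mul (mem_box.1 hz j) (E.abs_w i hi j) (abs_nonneg _) (Nat.cast_nonneg K)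
  · simp [brickBound]

/-- The brick `z` may follow the partial sum `σ` at position `i`, with step size `γ`. -/
def Step (A : Bimatrix r s t) (γ : ℤ) (i : ℕ) (σ z : Fin t → ℤ) : Prop :=
  z ∈ moves A K σ ∧
    (∀ j : Fin t, E.l (i * t + j) ≤ E.x (i * t + j) + γ * z j) ∧
      ∀ j : Fin t, E.x (i * t + j) + γ * z j ≤ E.u (i * t + j)

/-- `S` lists the partial sums of the bricks of a kernel vector `g` for which `γ g` is a feasible
step. -/
def IsPath (A : Bimatrix r s t) (γ : ℤ) (S : ℕ → Fin t → ℤ) : Prop :=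
  S 0 = 0 ∧ (∀ i < E.n, E.Step A γ i (S i) (S (i + 1) - S i)) ∧ A.fst.mulVec (S E.n) = 0

/-- The objective value of the vector with partial sums `S`. -/
def pathCost (S : ℕ → Fin t → ℤ) : ℤ :=
  ∑ i ∈ Finset.range E.n, E.gain i (S (i + 1) - S i)

/-- Since `x` itself is feasible, a path exists for every step size; the search thus never meets an
empty problem, and the zero path serves as the initial candidate. -/
theorem isPath_zero (A : Bimatrix r s t) (γ : ℤ) : E.IsPath A γ 0 := by
  refine ⟨rfl, fun i hi => ⟨mem_moves.2 ?_, fun j => ?_, fun j => ?_⟩, by simp⟩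
  · simp [zero_mem_box]
  · simpa using E.l_le_x i hi j
  · simpa using E.x_le_u i hi j

theorem pathCost_zero : E.pathCost 0 = 0 := by simp [pathCost, gain]

/-- `V σ i` and `C σ i` are the value and the code of an optimal continuation at position `i`,
given those at position `i + 1`; the code is `0` if there is none. -/
def LevelOK (A : Bimatrix r s t) (γ : ℤ) (V C : (Fin t → ℤ) → ℤ → ℤ) (i : ℕ) (σ : Fin t → ℤ) :
    Prop :=
  (C σ i = 0 ∧ ∀ z, E.Step A γ i σ z → ¬ 1 ≤ C (σ + z) (i + 1)) ∨
    ∃ z, E.Step A γ i σ z ∧ 1 ≤ C (σ + z) (i + 1) ∧ C σ i = Encodable.encode z + 1 ∧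
      V σ i = E.gain i z + V (σ + z) (i + 1) ∧
        ∀ z', E.Step A γ i σ z' → 1 ≤ C (σ + z') (i + 1) →
          V σ i ≤ E.gain i z' + V (σ + z') (i + 1)

/-- The tables are correct from position `i` on. -/
def TableOK (A : Bimatrix r s t) (γ : ℤ) (V C : (Fin t → ℤ) → ℤ → ℤ) (i : ℕ) : Prop :=
  (∀ σ ∈ box t K, V σ E.n = 0 ∧ C σ E.n = if A.fst.mulVec σ = 0 then 1 else 0) ∧
    ∀ m, i ≤ m → m < E.n → ∀ σ ∈ box t K, E.LevelOK A γ V C m σ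

/-! ### Bellman's principle for the tables -/

variable {E} {A : Bimatrix r s t} {γ : ℤ} {V C V' C' : (Fin t → ℤ) → ℤ → ℤ}

theorem LevelOK.congr {i : ℕ} {σ : Fin t → ℤ} (h : E.LevelOK A γ V C i σ)
    (hV : V' σ i = V σ i) (hC : C' σ i = C σ i)
    (hV' : ∀ ρ ∈ box t K, V' ρ (i + 1) = V ρ (i + 1))
    (hC' : ∀ ρ ∈ box t K, C' ρ (i + 1) = C ρ (i + 1)) : E.LevelOK A γ V' C' i σ := by
  have hb : ∀ z, E.Step A γ i σ z → σ + z ∈ box t K := fun z hz => (mem_moves.1 hz.1).2.2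
  rcases h with ⟨h1, h2⟩ | ⟨z, hz, h1, h2, h3, h4⟩
  · exact Or.inl ⟨hC.trans h1, fun z hz => by rw [hC' _ (hb z hz)]; exact h2 z hz⟩
  · refine Or.inr ⟨z, hz, ?_, hC.trans h2, ?_, fun z' hz' => ?_⟩
    · rwa [hC' _ (hb z hz)]
    · rw [hV, h3, hV' _ (hb z hz)]
    · rw [hV, hV' _ (hb z' hz'), hC' _ (hb z' hz')]
      exact h4 z' hz'

theorem TableOK.congr {i : ℕ} (h : E.TableOK A γ V C i)
    (hV : ∀ σ ∈ box t K, ∀ m : ℕ, i ≤ m → m ≤ E.n → V' σ m = V σ m)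
    (hC : ∀ σ ∈ box t K, ∀ m : ℕ, i ≤ m → m ≤ E.n → C' σ m = C σ m) (hi : i ≤ E.n) :
    E.TableOK A γ V' C' i := by
  refine ⟨fun σ hσ => ?_, fun m him hm σ hσ => ?_⟩
  · rw [hV σ hσ _ hi le_rfl, hC σ hσ _ hi le_rfl]
    exact h.1 σ hσ
  · exact (h.2 m him hm σ hσ).congr (hV σ hσ m him hm.le) (hC σ hσ m him hm.le)
      (fun ρ hρ => by exact_mod_cast hV ρ hρ (m + 1) (by omega) hm)
      (fun ρ hρ => by exact_mod_cast hC ρ hρ (m + 1) (by omega) hm)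

theorem TableOK.code_bounds {i : ℕ} (h : E.TableOK A γ V C i) (hi : i ≤ E.n) {σ : Fin t → ℤ}
    (hσ : σ ∈ box t K) : 0 ≤ C σ i ∧ C σ i ≤ E.D := by
  rcases hi.eq_or_lt with rfl | hi
  · rw [(h.1 σ hσ).2]
    have := E.one_le_D
    split_ifs <;> simp <;> omega
  · rcases h.2 i le_rfl hi σ hσ with ⟨h1, _⟩ | ⟨z, hz, _, h2, _⟩
    · have := E.one_le_D
      omega
    · have := E.code_le z (mem_moves.1 hz.1).1
      omega

/-- Follow the codes to the last position, adding at most `brickBound` per step. The positive code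
is essential: below the last position, the tables say nothing about a value whose code is `0`. -/
theorem TableOK.abs_value_le {i : ℕ} (h : E.TableOK A γ V C i) (hi : i ≤ E.n) {σ : Fin t → ℤ}
    (hσ : σ ∈ box t K) (hC : 1 ≤ C σ i) : |V σ i| ≤ ((E.n - i : ℕ) : ℤ) * E.brickBound := by
  induction hk : E.n - i generalizing i σ with
  | zero =>
    obtain rfl : i = E.n := by omega
    simp [(h.1 σ hσ).1]
  | succ k ih =>
    have hin : i < E.n := by omega
    rcases h.2 i le_rfl hin σ hσ with ⟨h1, _⟩ | ⟨z, hz, hCz, _, h3, _⟩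
    · omega
    have := ih (i := i + 1) (σ := σ + z) ⟨h.1, fun m hm => h.2 m (by omega)⟩ hin
      (mem_moves.1 hz.1).2.2 (by exact_mod_cast hCz) (by omega)
    rw [h3]
    refine (abs_add_le _ _).trans ?_
    have h4 := E.abs_gain_le hin (mem_moves.1 hz.1).1
    push_cast at this ⊢
    linarith

theorem IsPath.mem_box {S : ℕ → Fin t → ℤ} (h : E.IsPath A γ S) {i : ℕ} (hi : i ≤ E.n) :
    S i ∈ box t K := by
  cases i with
  | zero => rw [h.1]; exact zero_mem_box t K
  | succ i => simpa using (mem_moves.1 (h.2.1 i hi).1).2.2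

/-- Backward induction along the path: its remaining part is a continuation of its current partial
sum, so a code is present there and the tabulated value is no larger than the cost of that part. -/
theorem TableOK.le_pathCost (h : E.TableOK A γ V C 0) {S : ℕ → Fin t → ℤ}
    (hS : E.IsPath A γ S) : 1 ≤ C 0 0 ∧ V 0 0 ≤ E.pathCost S := by
  have key : ∀ k i, i + k = E.n → 1 ≤ C (S i) i ∧
      V (S i) i ≤ ∑ m ∈ Finset.Ico i E.n, E.gain m (S (m + 1) - S m) := by
    intro k
    induction k with
    | zero =>
      intro i hi
      obtain rfl : i = E.n := by omega
      obtain ⟨h1, h2⟩ := h.1 (S E.n) (hS.mem_box le_rfl)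
      rw [h1, h2, if_pos hS.2.2]
      simp
    | succ k ih =>
      intro i hi
      obtain ⟨h1, h2⟩ := ih (i + 1) (by omega)
      have hin : i < E.n := by omega
      have hst := hS.2.1 i hin
      have hadd : S i + (S (i + 1) - S i) = S (i + 1) := by simp
      rw [Finset.sum_eq_sum_Ico_succ_bot hin]
      rcases h.2 i (Nat.zero_le i) hin (S i) (hS.mem_box hin.le) with
        ⟨_, h4⟩ | ⟨z, hz, hCz, h3, _, h5⟩
      · exfalso
        apply h4 _ hst
        rw [hadd]
        exact_mod_cast h1
      · refine ⟨by omega, ?_⟩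
        have := h5 _ hst (by rw [hadd]; exact_mod_cast h1)
        rw [hadd] at this
        push_cast at h2
        linarith
  have := key E.n 0 (by simp)
  rw [hS.1] at this
  rw [pathCost, Finset.range_eq_Ico]
  exact_mod_cast this

end Env

end NFold

namespace NFold

variable {r s t K : ℕ}

/-! ### Memory -/

@[simp]
theorem State.setReg_reg (σ : State) (k k' : ℕ) (z : ℤ) :
    (σ.setReg k z).reg k' = if k' = k then z else σ.reg k' := by
  simp [State.setReg, Function.update_apply]

@[simp]
theorem State.setReg_arr (σ : State) (k : ℕ) (z : ℤ) : (σ.setReg k z).arr = σ.arr := rfl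

@[simp]
theorem State.setCell_reg (σ : State) (a : ℕ) (i z : ℤ) : (σ.setCell a i z).reg = σ.reg := rfl

@[simp]
theorem State.setCell_arr (σ : State) (a a' : ℕ) (i i' z : ℤ) :
    (σ.setCell a i z).arr a' i' = if a' = a ∧ i' = i then z else σ.arr a' i' := by
  by_cases h : a' = a
  · subst h
    simp [State.setCell, Function.update_apply]
  · simp [State.setCell, h]

/-- The memories `σ` and `τ` differ only in the registers `R` and in the cells `P`. -/
def Frame (R : ℕ → Prop) (P : ℕ → ℤ → Prop) (σ τ : State) : Prop :=
  (∀ k, ¬ R k → τ.reg k = σ.reg k) ∧ ∀ a i, ¬ P a i → τ.arr a i = σ.arr a i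

theorem Frame.refl (R : ℕ → Prop) (P : ℕ → ℤ → Prop) (σ : State) : Frame R P σ σ :=
  ⟨fun _ _ => rfl, fun _ _ _ => rfl⟩

theorem Frame.trans {R R' R'' : ℕ → Prop} {P P' P'' : ℕ → ℤ → Prop} {σ τ υ : State}
    (h : Frame R P σ τ) (h' : Frame R' P' τ υ) (hR : ∀ k, R k → R'' k) (hR' : ∀ k, R' k → R'' k)
    (hP : ∀ a i, P a i → P'' a i) (hP' : ∀ a i, P' a i → P'' a i) : Frame R'' P'' σ υ :=
  ⟨fun k hk => (h'.1 k fun h => hk (hR' k h)).trans (h.1 k fun h => hk (hR k h)),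
    fun a i hk => (h'.2 a i fun h => hk (hP' a i h)).trans (h.2 a i fun h => hk (hP a i h))⟩

theorem Frame.mono {R R' : ℕ → Prop} {P P' : ℕ → ℤ → Prop} {σ τ : State}
    (h : Frame R P σ τ) (hR : ∀ k, R k → R' k)
    (hP : ∀ a i, P a i → P' a i) : Frame R' P' σ τ :=
  h.trans (Frame.refl R P τ) hR hR hP hP

theorem Frame.setReg {R : ℕ → Prop} {P : ℕ → ℤ → Prop} {σ τ : State} (h : Frame R P σ τ)
    {k : ℕ} (hk : R k) (z : ℤ) : Frame R P σ (τ.setReg k z) := by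
  refine ⟨fun m hm => ?_, h.2⟩
  rw [State.setReg_reg, if_neg (by rintro rfl; exact hm hk)]
  exact h.1 m hm

theorem Frame.setCell {R : ℕ → Prop} {P : ℕ → ℤ → Prop} {σ τ : State} (h : Frame R P σ τ)
    {a : ℕ} {i : ℤ} (hP : P a i) (z : ℤ) : Frame R P σ (τ.setCell a i z) := by
  refine ⟨h.1, fun a' i' hk => ?_⟩
  rw [State.setCell_arr, if_neg (by rintro ⟨rfl, rfl⟩; exact hk hP)]
  exact h.2 a' i' hk

/-- The array of the values of the continuations of the partial sum `σ`. -/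
def valArr (σ : Fin t → ℤ) : ℕ := 6 + 2 * Encodable.encode σ

/-- The array of the codes of the first bricks of the continuations of the partial sum `σ`. -/
def codeArr (σ : Fin t → ℤ) : ℕ := 7 + 2 * Encodable.encode σ

theorem valArr_ne_codeArr (σ ρ : Fin t → ℤ) : valArr σ ≠ codeArr ρ := by
  unfold valArr codeArr
  omega

theorem valArr_inj {σ ρ : Fin t → ℤ} : valArr σ = valArr ρ ↔ σ = ρ := by
  rw [← Encodable.encode_inj (a := σ)]
  unfold valArr
  omega

theorem codeArr_inj {σ ρ : Fin t → ℤ} : codeArr σ = codeArr ρ ↔ σ = ρ := by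
  rw [← Encodable.encode_inj (a := σ)]
  unfold codeArr
  omega

def State.val (s : State) (σ : Fin t → ℤ) (i : ℤ) : ℤ := s.arr (valArr σ) i

def State.code (s : State) (σ : Fin t → ℤ) (i : ℤ) : ℤ := s.arr (codeArr σ) i

/-- The input is in its place. -/
structure Env.Loaded (E : Env t K) (s : State) : Prop where
  n : s.reg 0 = E.n
  w : s.arr 0 = E.w
  l : s.arr 2 = E.l
  u : s.arr 3 = E.u
  x : s.arr 4 = E.x

theorem Env.Loaded.frame {E : Env t K} {s τ : State} {R : ℕ → Prop} {P : ℕ → ℤ → Prop}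
    (h : E.Loaded s) (hf : Frame R P s τ) (hR : ¬ R 0) (hP : ∀ a i, P a i → 5 ≤ a) :
    E.Loaded τ := by
  have harr : ∀ a < 5, τ.arr a = s.arr a := fun a ha =>
    funext fun i => hf.2 a i fun h => by have := hP a i h; omega
  exact ⟨(hf.1 0 hR).trans h.n, (harr 0 (by norm_num)).trans h.w,
    (harr 2 (by norm_num)).trans h.l, (harr 3 (by norm_num)).trans h.u,
    (harr 4 (by norm_num)).trans h.x⟩

/-! ### One level of the dynamic program -/

/-- The address of coordinate `j` of the brick whose position is in register `k`. -/
def addr (k : ℕ) (j : Fin t) : Expr :=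
  Expr.op Op.add (Expr.op Op.mul (Expr.reg k) (Expr.const t)) (Expr.const j)

theorem addr_eval (s : State) (k : ℕ) (j : Fin t) :
    (addr k j).eval s = s.reg k * t + (j : ℕ) := rfl

theorem addr_fits (E : Env t K) {s : State} {k i : ℕ} (hk : s.reg k = i) (hi : i < E.n)
    (j : Fin t) : (addr k j).Fits E.B s := by
  have h1 : ((i : ℤ) + 1) * t ≤ E.M * E.D :=
    mul_le_mul (by have := E.n_le; omega) E.t_le (by positivity) (by linarith [E.one_le_M])
  have h0 : (0 : ℤ) ≤ i * t := by positivity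
  have h2 := E.four_mul_le_B
  have h3 := E.MD_nonneg
  have h4 := E.M_le_MD
  have h5 := E.D_le_MD
  have h6 := E.n_le
  have h7 := E.t_le
  have h8 := j.2
  simp only [addr, Expr.Fits, Expr.eval, Op.eval, hk, abs_le]
  refine ⟨⟨?_, ?_, ?_⟩, ?_, ?_⟩ <;> constructor <;> linarith

/-- The value after coordinate `j` has been changed by the step. -/
def moved (z : Fin t → ℤ) (j : Fin t) : Expr :=
  Expr.op Op.add (Expr.cell 4 (addr 3 j)) (Expr.op Op.mul (Expr.reg 1) (Expr.const (z j)))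

def next : Expr := Expr.op Op.add (Expr.reg 3) (Expr.const 1)

/-- The tests for the brick `z` to lead to the partial sum `ρ`. -/
def stepTests (ρ z : Fin t → ℤ) : List Test :=
  Test.le (Expr.const 1) (Expr.cell (codeArr ρ) next) ::
    ((List.finRange t).map (fun j => Test.le (Expr.cell 2 (addr 3 j)) (moved z j)) ++
      (List.finRange t).map fun j => Test.le (moved z j) (Expr.cell 3 (addr 3 j)))

def valueExpr (ρ z : Fin t → ℤ) (l : List (Fin t)) : Expr :=
  l.foldr (fun j e => Expr.op Op.add
    (Expr.op Op.mul (Expr.const (z j)) (Expr.cell 0 (addr 3 j))) e) (Expr.cell (valArr ρ) next)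

/-- The shift by one keeps the code `0` free for the absence of a continuation. -/
def update (σ z : Fin t → ℤ) : Prog :=
  Prog.seq (Prog.store (valArr σ) (Expr.reg 3) (Expr.reg 7))
    (Prog.store (codeArr σ) (Expr.reg 3) (Expr.const (Encodable.encode z + 1)))

/-- Tries the brick `z` after the partial sum `σ`. -/
def tryMove (σ z : Fin t → ℤ) : Prog :=
  guarded (stepTests (σ + z) z)
    (Prog.seq (Prog.assign 7 (valueExpr (σ + z) z (List.finRange t)))
      (Prog.ite (Test.eq (Expr.cell (codeArr σ) (Expr.reg 3)) (Expr.const 0)) (update σ z)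
        (Prog.ite (Test.le (Expr.reg 7) (Expr.cell (valArr σ) (Expr.reg 3))) (update σ z)
          Prog.skip)))

theorem tryMove_loopFree (σ z : Fin t → ℤ) : (tryMove σ z).LoopFree :=
  guarded_loopFree (by simp [Prog.LoopFree, update])

theorem abs_reg_le_B (E : Env t K) {s : State} {k i : ℕ} (hk : s.reg k = i) (hi : i ≤ E.n) :
    |s.reg k| ≤ E.B := by
  have h2 := E.four_mul_le_B
  have h3 := E.MD_nonneg
  have h4 := E.M_le_MD
  have h6 := E.n_le
  rw [hk, abs_le]
  constructor <;> linarith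

theorem one_le_B (E : Env t K) : 1 ≤ E.B := by
  linarith [E.four_mul_le_B, E.MD_nonneg, E.M_le_MD, E.one_le_M]

theorem next_fits (E : Env t K) {s : State} {i : ℕ} (hk : s.reg 3 = i) (hi : i < E.n) :
    next.Fits E.B s := by
  have h2 := E.four_mul_le_B
  have h3 := E.MD_nonneg
  have h4 := E.M_le_MD
  have h5 := E.one_le_M
  have h6 := E.n_le
  simp only [next, Expr.Fits, Expr.eval, Op.eval, hk, abs_le]
  refine ⟨?_, ?_, ?_⟩ <;> constructor <;> linarith

theorem moved_fits (E : Env t K) {s : State} (hs : E.Loaded s) {i : ℕ} (hk : s.reg 3 = i)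
    (hi : i < E.n) (hγ : 1 ≤ s.reg 1) (hγ' : s.reg 1 ≤ 2 * E.M) {z : Fin t → ℤ}
    (hz : z ∈ box t K) (j : Fin t) : (moved z j).Fits E.B s := by
  have h2 := E.four_mul_le_B
  have h3 := E.MD_nonneg
  have h4 := E.M_le_MD
  have h5 := E.D_le_MD
  have h6 := E.abs_x hi j
  have h7 : |z j| ≤ E.D := (mem_box.1 hz j).trans E.K_le
  have h8 : |s.reg 1| ≤ 2 * E.M := abs_le.2 ⟨by linarith, hγ'⟩
  have h9 : |s.reg 1 * z j| ≤ 2 * E.M * E.D := by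
    rw [abs_mul]
    exact mul_le_mul h8 h7 (abs_nonneg _) (by linarith [E.one_le_M])
  have h10 := abs_add_le (E.x (i * t + j)) (s.reg 1 * z j)
  simp only [moved, Expr.Fits, Expr.eval, Op.eval, addr_eval, hk, hs.x]
  exact ⟨⟨addr_fits E hk hi j, by linarith⟩,
    ⟨by linarith, by linarith, by linarith⟩, by linarith⟩

theorem valueExpr_eval (s : State) (ρ z : Fin t → ℤ) (l : List (Fin t)) :
    (valueExpr ρ z l).eval s =
      (l.map fun j : Fin t => s.arr 0 (s.reg 3 * t + (j : ℕ)) * z j).sum + s.val ρ (s.reg 3 + 1) := by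
  induction l with
  | nil => simp [valueExpr, Expr.eval, Op.eval, next, State.val]
  | cons j l ih =>
    rw [List.map_cons, List.sum_cons, add_assoc, ← ih]
    simp [valueExpr, Expr.eval, Op.eval, addr_eval, mul_comm]

/-- Every intermediate sum has to respect the size bound, so the induction runs over the suffixes of
the coordinate list, each coordinate adding at most `K M` to the tabulated value. -/
theorem valueExpr_fits (E : Env t K) {s : State} (hs : E.Loaded s) {i : ℕ} (hk : s.reg 3 = i)
    (hi : i < E.n) {ρ z : Fin t → ℤ} (hz : z ∈ box t K) {b : ℤ}
    (hρ : |s.val ρ (i + 1)| ≤ b) {l : List (Fin t)} (hl : l.length ≤ t)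
    (hb : b + E.brickBound ≤ E.B) :
    (valueExpr ρ z l).Fits E.B s ∧ |(valueExpr ρ z l).eval s| ≤ b + l.length * (K * E.M) := by
  have hKM : 0 ≤ K * E.M := mul_nonneg (Nat.cast_nonneg K) (by linarith [E.one_le_M])
  have hb0 := (abs_nonneg _).trans hρ
  have hle : ∀ m : ℕ, m ≤ t → b + m * (K * E.M) ≤ E.B := fun m hm => by
    have : (m : ℤ) * (K * E.M) ≤ t * (K * E.M) :=
      mul_le_mul_of_nonneg_right (by exact_mod_cast hm) hKM
    exact le_trans (by unfold Env.brickBound; linarith) hb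
  have h2 := E.four_mul_le_B
  have h3 := E.MD_nonneg
  have h4 := E.M_le_MD
  have h5 := E.D_le_MD
  induction l with
  | nil =>
    have hv : |(valueExpr ρ z []).eval s| ≤ b := by
      rw [valueExpr_eval, hk]
      simpa using hρ
    have := hle 0 (Nat.zero_le t)
    refine ⟨⟨next_fits E hk hi, hv.trans ?_⟩, hv.trans ?_⟩
    · simpa using this
    · simp
  | cons j l ih =>
    rw [List.length_cons] at hl
    obtain ⟨ih1, ih2⟩ := ih (by omega)
    have hw := E.abs_w i hi j
    have hzj := mem_box.1 hz j
    have hwz : |z j * E.w (i * t + j)| ≤ K * E.M := by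
      rw [abs_mul]
      exact mul_le_mul hzj hw (abs_nonneg _) (Nat.cast_nonneg K)
    have hsum : |(valueExpr ρ z (j :: l)).eval s| ≤ b + (l.length + 1 : ℕ) * (K * E.M) := by
      change |z j * s.arr 0 (s.reg 3 * t + (j : ℕ)) + (valueExpr ρ z l).eval s| ≤ _
      rw [hk, hs.w]
      refine (abs_add_le _ _).trans ?_
      push_cast
      linarith
    refine ⟨⟨⟨?_, ⟨addr_fits E hk hi j, ?_⟩, ?_⟩, ih1, ?_⟩, hsum⟩
    · have := E.K_le
      change |z j| ≤ _
      linarith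
    · rw [addr_eval, hk, hs.w]
      linarith
    · simp only [Expr.eval, Op.eval, addr_eval, hk, hs.w]
      have := hle 1 (by omega)
      push_cast at this
      linarith
    · exact hsum.trans (hle _ hl)

/-- The state after the bricks `pre` have been tried after the partial sum `σ`. -/
def Tried (E : Env t K) (A : Bimatrix r s t) (γ : ℤ) (i : ℕ) (σ : Fin t → ℤ) (s₀ : State)
    (pre : List (Fin t → ℤ)) (τ : State) : Prop :=
  Frame (· = 7) (fun a j => (a = valArr σ ∨ a = codeArr σ) ∧ j = i) s₀ τ ∧
    ((τ.code σ i = 0 ∧ ∀ z ∈ pre, E.Step A γ i σ z → ¬ 1 ≤ s₀.code (σ + z) (i + 1)) ∨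
      ∃ z, E.Step A γ i σ z ∧ 1 ≤ s₀.code (σ + z) (i + 1) ∧
        τ.code σ i = Encodable.encode z + 1 ∧
          τ.val σ i = E.gain i z + s₀.val (σ + z) (i + 1) ∧
            ∀ z' ∈ pre, E.Step A γ i σ z' → 1 ≤ s₀.code (σ + z') (i + 1) →
              τ.val σ i ≤ E.gain i z' + s₀.val (σ + z') (i + 1))

theorem Frame.val_code {R : ℕ → Prop} {i : ℕ} {σ : Fin t → ℤ} {s τ : State}
    (h : Frame R (fun a j => (a = valArr σ ∨ a = codeArr σ) ∧ j = i) s τ) {ρ : Fin t → ℤ} {m : ℤ}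
    (hm : m ≠ i ∨ ρ ≠ σ) : τ.val ρ m = s.val ρ m ∧ τ.code ρ m = s.code ρ m := by
  constructor
  · apply h.2
    rintro ⟨h1 | h1, h2⟩
    · rw [valArr_inj] at h1
      tauto
    · exact valArr_ne_codeArr _ _ h1
  · apply h.2
    rintro ⟨h1 | h1, h2⟩
    · exact valArr_ne_codeArr _ _ h1.symm
    · rw [codeArr_inj] at h1
      tauto

theorem update_wp (E : Env t K) {A : Bimatrix r s t} {γ : ℤ} {i : ℕ} {σ z : Fin t → ℤ}
    {s₀ τ : State} {pre : List (Fin t → ℤ)}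
    (hF : Frame (· = 7) (fun a j => (a = valArr σ ∨ a = codeArr σ) ∧ j = i) s₀ τ)
    (h3 : τ.reg 3 = i) (hi : i < E.n) (hz : E.Step A γ i σ z)
    (hC : 1 ≤ s₀.code (σ + z) (i + 1)) (h7 : τ.reg 7 = E.gain i z + s₀.val (σ + z) (i + 1))
    (h7' : |τ.reg 7| ≤ E.B)
    (hpre : ∀ z' ∈ pre, E.Step A γ i σ z' → 1 ≤ s₀.code (σ + z') (i + 1) →
      τ.reg 7 ≤ E.gain i z' + s₀.val (σ + z') (i + 1)) :
    WP E.B (update σ z) τ (Tried E A γ i σ s₀ (z :: pre)) := by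
  have hr3 : |τ.reg 3| ≤ E.B := abs_reg_le_B E h3 hi.le
  have hcode : |(Encodable.encode z : ℤ) + 1| ≤ E.B := by
    rw [abs_of_nonneg (by positivity)]
    linarith [E.code_le z (mem_moves.1 hz.1).1, E.four_mul_le_B, E.D_le_MD, E.MD_nonneg]
  refine WP.seq (WP.store hr3 h7' (WP.store hr3 hcode ⟨?_, Or.inr ⟨z, hz, hC, ?_, ?_, ?_⟩⟩))
  · exact (hF.setCell ⟨Or.inl rfl, h3⟩ _).setCell ⟨Or.inr rfl, h3⟩ _
  · simp [State.code, Expr.eval, h3]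
  · simp [State.val, Expr.eval, h3, valArr_ne_codeArr, h7]
  · intro z' hz' hst hc
    simp only [State.val, Expr.eval, h3, State.setCell_arr, valArr_ne_codeArr, State.setCell_reg,
      false_and, if_false, and_self, if_true]
    rcases List.mem_cons.1 hz' with rfl | hz'
    · exact h7.le
    · exact hpre z' hz' hst hc

/-- Running minimum: the entry is overwritten if it is empty or if the new value is no larger. The
table at position `i + 1` is untouched meanwhile, so all comparisons refer to the fixed memory `s₀`.
-/
theorem tryMove_wp (E : Env t K) {A : Bimatrix r s t} {s₀ : State} (hs : E.Loaded s₀)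
    (hγ : 1 ≤ s₀.reg 1) (hγ' : s₀.reg 1 ≤ 2 * E.M) {i : ℕ} (h3 : s₀.reg 3 = i) (hi : i < E.n)
    (hT : E.TableOK A (s₀.reg 1) s₀.val s₀.code (i + 1)) {σ z : Fin t → ℤ}
    (hz : z ∈ moves A K σ) {pre : List (Fin t → ℤ)} {τ : State}
    (hτ : Tried E A (s₀.reg 1) i σ s₀ pre τ) :
    WP E.B (tryMove σ z) τ (Tried E A (s₀.reg 1) i σ s₀ (z :: pre)) := by
  obtain ⟨hF, hτ⟩ := hτ
  have hr : ∀ k, k ≠ 7 → τ.reg k = s₀.reg k := fun k hk => hF.1 k hk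
  have hL : E.Loaded τ := hs.frame hF (by norm_num) (by
    rintro a j ⟨rfl | rfl, -⟩
    · unfold valArr; omega
    · unfold codeArr; omega)
  have h3τ : τ.reg 3 = i := (hr 3 (by norm_num)).trans h3
  have h1τ : τ.reg 1 = s₀.reg 1 := hr 1 (by norm_num)
  obtain ⟨hzb, -, hρ⟩ := mem_moves.1 hz
  have hne : ((i : ℤ) + 1) ≠ i := by omega
  have hcode := (hF.val_code (ρ := σ + z) (Or.inl hne)).2
  have hval := (hF.val_code (ρ := σ + z) (Or.inl hne)).1
  obtain ⟨hc0, hcD⟩ := hT.code_bounds hi hρ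
  have hDB : E.D ≤ E.B := by linarith [E.four_mul_le_B, E.D_le_MD, E.MD_nonneg]
  have hMB : E.M ≤ E.B := by linarith [E.four_mul_le_B, E.M_le_MD, E.MD_nonneg]
  -- The kernel and box conditions of a step do not depend on the instance and are built into the
  -- program through `moves`; only the bounds and the existence of a continuation are tested at run
  -- time.
  have hholds : (∀ c ∈ stepTests (σ + z) z, c.Holds τ) ↔
      1 ≤ s₀.code (σ + z) (i + 1) ∧ E.Step A (s₀.reg 1) i σ z := by
    simp only [stepTests, List.forall_mem_cons, List.forall_mem_append, List.forall_mem_map,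
      Test.Holds, moved, Expr.eval, Op.eval, addr_eval, next, h3τ, h1τ, hL.x, hL.l, hL.u]
    rw [← hcode]
    simp [Env.Step, hz, State.code]
  refine WP.guarded ?_ (fun h => ?_) fun h => ?_
  · simp only [stepTests, List.forall_mem_cons, List.forall_mem_append, List.forall_mem_map]
    refine ⟨⟨by simpa [Expr.Fits] using one_le_B E, next_fits E h3τ hi, ?_⟩,
      fun j _ => ⟨⟨addr_fits E h3τ hi j, ?_⟩, moved_fits E hL h3τ hi (h1τ ▸ hγ) (h1τ ▸ hγ') hzb j⟩,
      fun j _ => ⟨moved_fits E hL h3τ hi (h1τ ▸ hγ) (h1τ ▸ hγ') hzb j, addr_fits E h3τ hi j, ?_⟩⟩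
    · have : τ.arr (codeArr (σ + z)) (next.eval τ) = τ.code (σ + z) (i + 1) := by
        simp [next, Expr.eval, Op.eval, h3τ, State.code]
      rw [this, hcode, abs_le]
      push_cast at hc0 hcD
      constructor <;> linarith
    · rw [addr_eval, h3τ, hL.l]
      exact (E.abs_l i hi j).trans hMB
    · rw [addr_eval, h3τ, hL.u]
      exact (E.abs_u i hi j).trans hMB
  · obtain ⟨hC, hst⟩ := hholds.1 h
    have hv := hT.abs_value_le hi hρ (by exact_mod_cast hC)
    rw [Nat.cast_add_one] at hv
    have hnn : (((E.n - (i + 1) : ℕ) : ℤ) + 1) * E.brickBound ≤ E.B := by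
      refine le_trans (mul_le_mul_of_nonneg_right ?_ E.brickBound_nonneg) E.value_le_B
      omega
    obtain ⟨hfit, habs⟩ := valueExpr_fits E hL h3τ hi (ρ := σ + z) hzb
      (hval ▸ hv) (l := List.finRange t) (by simp) (by linarith)
    have heval : (valueExpr (σ + z) z (List.finRange t)).eval τ =
        E.gain i z + s₀.val (σ + z) (i + 1) := by
      rw [valueExpr_eval, h3τ, hval, hL.w, Env.gain, Fin.sum_univ_def]
    have habs' : |(valueExpr (σ + z) z (List.finRange t)).eval τ| ≤ E.B := by
      refine habs.trans ?_
      rw [List.length_finRange]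
      change _ + E.brickBound ≤ _
      linarith
    refine WP.seq (WP.assign hfit ?_)
    rw [heval] at habs' ⊢
    set τ' := τ.setReg 7 (E.gain i z + s₀.val (σ + z) (i + 1)) with hτ'
    have hF' : Frame (· = 7) (fun a j => (a = valArr σ ∨ a = codeArr σ) ∧ j = i) s₀ τ' :=
      hF.setReg rfl _
    have h3' : τ'.reg 3 = i := by simp [hτ', h3τ]
    have h7' : τ'.reg 7 = E.gain i z + s₀.val (σ + z) (i + 1) := by simp [hτ']
    have hc' : τ'.code σ i = τ.code σ i := rfl
    have hv' : τ'.val σ i = τ.val σ i := rfl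
    have hr3 : |τ'.reg 3| ≤ E.B := abs_reg_le_B E h3' hi.le
    have hcell : τ'.arr (codeArr σ) (τ'.reg 3) = τ.code σ i := by rw [h3']; rfl
    have hcell' : τ'.arr (valArr σ) (τ'.reg 3) = τ.val σ i := by rw [h3']; rfl
    have h7B : |τ'.reg 7| ≤ E.B := h7' ▸ habs'
    refine WP.ite ⟨⟨hr3, ?_⟩, ?_⟩ (fun h0 => ?_) fun h0 => ?_
    · change |τ'.arr (codeArr σ) (τ'.reg 3)| ≤ _
      rw [hcell]
      rcases hτ with ⟨h1, _⟩ | ⟨z', hz', _, h1, _⟩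
      · rw [h1, abs_zero]
        linarith [one_le_B E]
      · rw [h1, abs_of_nonneg (by positivity)]
        linarith [E.code_le z' (mem_moves.1 hz'.1).1]
    · simpa [Expr.Fits] using (zero_le_one.trans (one_le_B E))
    -- With an empty entry no earlier brick was admissible, so the comparison with the earlier ones
    -- is vacuous.
    · refine update_wp E hF' h3' hi hst hC h7' h7B fun z' hz' hst' hc'' => ?_
      change τ'.arr (codeArr σ) (τ'.reg 3) = 0 at h0
      rw [hcell] at h0
      rcases hτ with ⟨_, h1⟩ | ⟨z', hz', _, h1, _⟩
      · exact absurd hc'' (h1 z' hz' hst')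
      · omega
    · change ¬ τ'.arr (codeArr σ) (τ'.reg 3) = 0 at h0
      rw [hcell] at h0
      rcases hτ with ⟨h1, _⟩ | ⟨y, hy, hyC, h1, h2, h4⟩
      · exact absurd h1 h0
      have hyv := hT.abs_value_le hi (mem_moves.1 hy.1).2.2 (by exact_mod_cast hyC)
      have hyg := E.abs_gain_le hi (mem_moves.1 hy.1).1
      have hyB : |τ.val σ i| ≤ E.B := by
        rw [h2]
        refine (abs_add_le _ _).trans ?_
        push_cast at hyv
        linarith
      refine WP.ite ⟨h7B, hr3, ?_⟩ (fun hle => ?_) fun hle => WP.skip ?_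
      · change |τ'.arr (valArr σ) (τ'.reg 3)| ≤ _
        rwa [hcell']
      · change τ'.reg 7 ≤ τ'.arr (valArr σ) (τ'.reg 3) at hle
        rw [hcell'] at hle
        exact update_wp E hF' h3' hi hst hC h7' h7B fun z' hz' hst' hc'' =>
          hle.trans (h4 z' hz' hst' hc'')
      · change ¬ τ'.reg 7 ≤ τ'.arr (valArr σ) (τ'.reg 3) at hle
        rw [hcell'] at hle
        refine ⟨hF', Or.inr ⟨y, hy, hyC, h1, h2, fun z' hz' hst' hc'' => ?_⟩⟩
        rcases List.mem_cons.1 hz' with rfl | hz'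
        · rw [← h7']
          exact (not_le.1 hle).le
        · exact h4 z' hz' hst' hc''
  · refine ⟨hF, ?_⟩
    rw [hholds] at h
    rcases hτ with ⟨h1, h2⟩ | ⟨y, hy, hyC, h1, h2, h4⟩
    · refine Or.inl ⟨h1, fun z' hz' hst => ?_⟩
      rcases List.mem_cons.1 hz' with rfl | hz'
      · exact fun hC => h ⟨hC, hst⟩
      · exact h2 z' hz' hst
    · refine Or.inr ⟨y, hy, hyC, h1, h2, fun z' hz' hst hC => ?_⟩
      rcases List.mem_cons.1 hz' with rfl | hz'
      · exact absurd ⟨hC, hst⟩ h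
      · exact h4 z' hz' hst hC

end NFold

namespace NFold

variable {r s t K : ℕ}

/-! ### The dynamic program for a fixed step size -/

/-- Computes the entries of the tables for the partial sum `σ` at one position. -/
noncomputable def entry (A : Bimatrix r s t) (K : ℕ) (σ : Fin t → ℤ) : Prog :=
  Prog.seq (Prog.store (codeArr σ) (Expr.reg 3) (Expr.const 0))
    (forEach (moves A K σ) (tryMove σ))

/-- Computes the tables at one position. -/
noncomputable def level (A : Bimatrix r s t) (K : ℕ) : Prog := forEach (box t K) (entry A K)

theorem level_loopFree (A : Bimatrix r s t) (K : ℕ) : (level A K).LoopFree :=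
  forEach_loopFree fun _ => ⟨trivial, forEach_loopFree fun _ => tryMove_loopFree _ _⟩

theorem entry_wp (E : Env t K) {A : Bimatrix r s t} {s₀ : State} (hs : E.Loaded s₀)
    (hγ : 1 ≤ s₀.reg 1) (hγ' : s₀.reg 1 ≤ 2 * E.M) {i : ℕ} (h3 : s₀.reg 3 = i) (hi : i < E.n)
    (hT : E.TableOK A (s₀.reg 1) s₀.val s₀.code (i + 1)) (σ : Fin t → ℤ) :
    WP E.B (entry A K σ) s₀ fun τ =>
      Frame (· = 7) (fun a j => (a = valArr σ ∨ a = codeArr σ) ∧ j = i) s₀ τ ∧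
        E.LevelOK A (s₀.reg 1) τ.val τ.code i σ := by
  have hne : ∀ m : ℕ, i + 1 ≤ m → ((m : ℤ) ≠ i) := fun m hm => by omega
  refine WP.seq (WP.store (abs_reg_le_B E h3 hi.le) ?_ ?_)
  · simpa [Expr.Fits] using zero_le_one.trans (one_le_B E)
  set s₁ := s₀.setCell (codeArr σ) ((Expr.reg 3).eval s₀) ((Expr.const 0).eval s₀) with hs₁
  have hF : Frame (· = 7) (fun a j => (a = valArr σ ∨ a = codeArr σ) ∧ j = i) s₀ s₁ :=
    (Frame.refl _ _ _).setCell ⟨Or.inr rfl, h3⟩ _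
  have hL : E.Loaded s₁ := hs.frame hF (by norm_num) (by
    rintro a j ⟨rfl | rfl, -⟩
    · unfold valArr; omega
    · unfold codeArr; omega)
  have h3' : s₁.reg 3 = i := h3
  have hT' : E.TableOK A (s₁.reg 1) s₁.val s₁.code (i + 1) :=
    hT.congr (fun ρ _ m hm _ => (hF.val_code (Or.inl (hne m hm))).1)
      (fun ρ _ m hm _ => (hF.val_code (Or.inl (hne m hm))).2) hi
  -- Storing `0` first erases whatever code an earlier step size may have left in this cell.
  have hT0 : Tried E A (s₁.reg 1) i σ s₁ [] s₁ := by
    refine ⟨Frame.refl _ _ _, Or.inl ⟨?_, by simp⟩⟩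
    simp [hs₁, State.code, Expr.eval, h3]
  refine (WP.forEach (Tried E A (s₁.reg 1) i σ s₁)
    (fun pre z hz τ hτ => tryMove_wp E hL hγ hγ' h3' hi hT' hz hτ) [] hT0).mono fun τ hτ => ?_
  obtain ⟨hF', hτ⟩ := hτ
  refine ⟨hF.trans hF' (fun _ => id) (fun _ => id) (fun _ _ => id) (fun _ _ => id), ?_⟩
  have hmem : ∀ z, E.Step A (s₁.reg 1) i σ z → z ∈ (moves A K σ).reverse ++ [] := fun z hz => by
    simpa using hz.1
  have hc : ∀ ρ : Fin t → ℤ, τ.code ρ (i + 1) = s₁.code ρ (i + 1) := fun ρ =>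
    (hF'.val_code (Or.inl (by omega))).2
  have hv : ∀ ρ : Fin t → ℤ, τ.val ρ (i + 1) = s₁.val ρ (i + 1) := fun ρ =>
    (hF'.val_code (Or.inl (by omega))).1
  simp only [Env.LevelOK, hc, hv]
  rcases hτ with ⟨h1, h2⟩ | ⟨y, hy, hyC, h1, h2, h4⟩
  · exact Or.inl ⟨h1, fun z hz => h2 z (hmem z hz) hz⟩
  · exact Or.inr ⟨y, hy, hyC, h1, h2, fun z hz => h4 z (hmem z hz) hz⟩

theorem level_wp (E : Env t K) {A : Bimatrix r s t} {s₀ : State} (hs : E.Loaded s₀)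
    (hγ : 1 ≤ s₀.reg 1) (hγ' : s₀.reg 1 ≤ 2 * E.M) {i : ℕ} (h3 : s₀.reg 3 = i) (hi : i < E.n)
    (hT : E.TableOK A (s₀.reg 1) s₀.val s₀.code (i + 1)) :
    WP E.B (level A K) s₀ fun τ => Frame (· = 7) (fun a j => 6 ≤ a ∧ j = i) s₀ τ ∧
      E.TableOK A (s₀.reg 1) τ.val τ.code i := by
  have h6 : ∀ (σ : Fin t → ℤ) a (j : ℤ), (a = valArr σ ∨ a = codeArr σ) ∧ j = i →
      6 ≤ a ∧ j = i := by
    rintro σ a j ⟨rfl | rfl, h⟩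
    · exact ⟨by unfold valArr; omega, h⟩
    · exact ⟨by unfold codeArr; omega, h⟩
  have hval : ∀ {τ : State}, Frame (· = 7) (fun a j => 6 ≤ a ∧ j = (i : ℤ)) s₀ τ →
      ∀ (ρ : Fin t → ℤ) (m : ℕ), i + 1 ≤ m →
        τ.val ρ m = s₀.val ρ m ∧ τ.code ρ m = s₀.code ρ m := by
    intro τ hF ρ m hm
    exact ⟨hF.2 _ _ fun h => by omega, hF.2 _ _ fun h => by omega⟩
  have hTτ : ∀ {τ : State}, Frame (· = 7) (fun a j => 6 ≤ a ∧ j = (i : ℤ)) s₀ τ →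
      E.TableOK A (s₀.reg 1) τ.val τ.code (i + 1) := fun hF =>
    hT.congr (fun ρ _ m hm _ => (hval hF ρ m hm).1) (fun ρ _ m hm _ => (hval hF ρ m hm).2) hi
  refine (WP.forEach_and (fun τ => Frame (· = 7) (fun a j => 6 ≤ a ∧ j = i) s₀ τ)
    (fun σ τ => E.LevelOK A (s₀.reg 1) τ.val τ.code i σ) (fun σ _ τ hF => ?_)
    (Frame.refl _ _ _)).mono fun τ hτ => ⟨hτ.1, ?_⟩
  · have hr : ∀ k, k ≠ 7 → τ.reg k = s₀.reg k := fun k hk => hF.1 k hk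
    have h1 := hr 1 (by norm_num)
    have hL : E.Loaded τ := hs.frame hF (by norm_num) (fun a j h => by omega)
    refine (entry_wp E hL (h1 ▸ hγ) (h1 ▸ hγ') ((hr 3 (by norm_num)).trans h3) hi
      (h1.symm ▸ hTτ hF) σ).mono fun υ hυ => ?_
    rw [h1] at hυ
    refine ⟨hF.trans hυ.1 (fun _ => id) (fun _ => id) (fun _ _ => id) (h6 σ), hυ.2, ?_⟩
    intro ρ _ hρσ hρ
    -- Entries at position `i` read only position `i + 1`, and different partial sums own different
    -- arrays; so computing the entry for `σ` keeps the one for `ρ` correct.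
    refine hρ.congr (hυ.1.val_code (Or.inr hρσ)).1 (hυ.1.val_code (Or.inr hρσ)).2
      (fun ρ' _ => (hυ.1.val_code (Or.inl (by omega))).1)
      (fun ρ' _ => (hυ.1.val_code (Or.inl (by omega))).2)
  · refine ⟨(hTτ hτ.1).1, fun m him hm σ hσ => ?_⟩
    rcases him.eq_or_lt with rfl | him
    · exact hτ.2 σ hσ
    · exact (hTτ hτ.1).2 m him hm σ hσ

/-- Fills in the tables behind the last position. -/
noncomputable def lastLevel (A : Bimatrix r s t) (K : ℕ) : Prog :=
  forEach (box t K) fun σ => Prog.seq (Prog.store (valArr σ) (Expr.reg 0) (Expr.const 0))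
    (Prog.store (codeArr σ) (Expr.reg 0) (Expr.const (if A.fst.mulVec σ = 0 then 1 else 0)))

theorem lastLevel_loopFree (A : Bimatrix r s t) (K : ℕ) : (lastLevel A K).LoopFree :=
  forEach_loopFree fun _ => ⟨trivial, trivial⟩

theorem lastLevel_wp (E : Env t K) {A : Bimatrix r s t} {s₀ : State} (hs : E.Loaded s₀) (γ : ℤ) :
    WP E.B (lastLevel A K) s₀ fun τ => Frame (fun k => k = 3 ∨ k = 7) (fun a _ => 6 ≤ a) s₀ τ ∧
      E.TableOK A γ τ.val τ.code E.n := by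
  refine (WP.forEach_and (fun τ => Frame (fun k => k = 3 ∨ k = 7) (fun a _ => 6 ≤ a) s₀ τ)
    (fun σ τ => τ.val σ E.n = 0 ∧ τ.code σ E.n = if A.fst.mulVec σ = 0 then 1 else 0)
    (fun σ _ τ hF => ?_) (Frame.refl _ _ _)).mono fun τ hτ =>
      ⟨hτ.1, hτ.2, fun m h1 h2 => absurd h1 (by omega)⟩
  have h0 : τ.reg 0 = E.n := (hF.1 0 (by norm_num)).trans hs.n
  have hr : |τ.reg 0| ≤ E.B := abs_reg_le_B E h0 le_rfl
  have hB := one_le_B E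
  refine WP.seq (WP.store hr ?_ (WP.store hr ?_ ⟨?_, ⟨?_, ?_⟩, ?_⟩))
  · simp only [Expr.Fits, abs_zero]
    linarith
  · simp only [Expr.Fits]
    split_ifs <;> simp <;> linarith
  · refine (hF.setCell ?_ _).setCell ?_ _
    · unfold valArr; omega
    · unfold codeArr; omega
  · simp [State.val, Expr.eval, h0, valArr_ne_codeArr]
  · simp [State.code, Expr.eval, h0]
  · rintro ρ _ hρ ⟨h1, h2⟩
    constructor
    · simpa [State.val, valArr_ne_codeArr, valArr_inj, hρ] using h1
    · simpa [State.code, (valArr_ne_codeArr _ _).symm, codeArr_inj, hρ] using h2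

/-- Computes the tables for the step size in register `1`. -/
noncomputable def tables (A : Bimatrix r s t) (K : ℕ) : Prog :=
  Prog.seq (lastLevel A K) (Prog.seq (Prog.assign 3 (Expr.reg 0))
    (Prog.loop (Test.le (Expr.const 1) (Expr.reg 3))
      (Prog.seq (Prog.assign 3 (Expr.op Op.sub (Expr.reg 3) (Expr.const 1))) (level A K))))

noncomputable def tablesCost (A : Bimatrix r s t) (K : ℕ) : ℕ :=
  (lastLevel A K).cost + (level A K).cost + 7

theorem countdown_fits (E : Env t K) {s : State} {k m : ℕ} (hk : s.reg k = m) (hm : m ≤ E.n) :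
    (Test.le (Expr.const 1) (Expr.reg k)).Fits E.B s ∧
      ((Test.le (Expr.const 1) (Expr.reg k)).Holds s ↔ m ≠ 0) ∧
        (0 < m → (Expr.op Op.sub (Expr.reg k) (Expr.const 1)).Fits E.B s) := by
  have h1 := abs_reg_le_B E hk hm
  have h2 := one_le_B E
  refine ⟨⟨by simpa [Expr.Fits] using h2, h1⟩, ?_, fun h0 => ⟨h1, by simpa [Expr.Fits] using h2, ?_⟩⟩
  · simp only [Test.Holds, Expr.eval, hk]
    omega
  · simp only [Expr.eval, Op.eval]
    rw [hk, abs_le] at *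
    omega

theorem tables_twp (E : Env t K) {A : Bimatrix r s t} {s₀ : State} (hs : E.Loaded s₀)
    (hγ : 1 ≤ s₀.reg 1) (hγ' : s₀.reg 1 ≤ 2 * E.M) :
    TWP E.B (tables A K) s₀ (tablesCost A K * (E.n + 1)) fun τ =>
      Frame (fun k => k = 3 ∨ k = 7) (fun a _ => 6 ≤ a) s₀ τ ∧
        E.TableOK A (s₀.reg 1) τ.val τ.code 0 := by
  let I : ℕ → State → Prop := fun m τ => m ≤ E.n ∧ τ.reg 3 = m ∧
    Frame (fun k => k = 3 ∨ k = 7) (fun a _ => 6 ≤ a) s₀ τ ∧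
      E.TableOK A (s₀.reg 1) τ.val τ.code m
  have hloop : ∀ m τ, I (m + 1) τ → TWP E.B
      (Prog.seq (Prog.assign 3 (Expr.op Op.sub (Expr.reg 3) (Expr.const 1))) (level A K)) τ
      (4 + (level A K).cost) (I m) := by
    rintro m τ ⟨hm, h3, hF, hT⟩
    refine TWP.seq (TWP.assign ((countdown_fits E h3 hm).2.2 (Nat.succ_pos m)) ?_)
    set τ' := τ.setReg 3 ((Expr.op Op.sub (Expr.reg 3) (Expr.const 1)).eval τ)
    have h3' : τ'.reg 3 = m := by
      simp [τ', Expr.eval, Op.eval, h3]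
    have hF' : Frame (fun k => k = 3 ∨ k = 7) (fun a _ => 6 ≤ a) s₀ τ' := hF.setReg (Or.inl rfl) _
    have hL : E.Loaded τ' := hs.frame hF' (by norm_num) fun a j h => by omega
    have h1 : τ'.reg 1 = s₀.reg 1 := hF'.1 1 (by norm_num)
    refine ((level_wp E hL (h1 ▸ hγ) (h1 ▸ hγ') h3' hm (h1.symm ▸ hT)).timed
      (level_loopFree A K)).mono le_rfl fun υ hυ => ?_
    rw [h1] at hυ
    exact ⟨by omega, (hυ.1.1 3 (by norm_num)).trans h3',
      hF'.trans hυ.1 (fun _ => id) (fun _ h => Or.inr h) (fun _ _ => id) (fun _ _ h => h.1), hυ.2⟩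
  refine TWP.mono (TWP.seq (((lastLevel_wp E hs (s₀.reg 1)).timed (lastLevel_loopFree A K)).mono
    le_rfl fun τ hτ => TWP.seq (TWP.assign (abs_reg_le_B E
      ((hτ.1.1 0 (by norm_num)).trans hs.n) le_rfl) (TWP.loop I ?_ ?_ hloop E.n ?_)))) ?_ ?_
  · exact fun m τ h => (countdown_fits E h.2.1 h.1).1
  · exact fun m τ h => (countdown_fits E h.2.1 h.1).2.1
  · refine ⟨le_rfl, ?_, hτ.1.setReg (Or.inl rfl) _, hτ.2⟩
    simp [Expr.eval, (hτ.1.1 0 (by norm_num)).trans hs.n]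
  · simp only [tablesCost, Expr.cost, Test.cost]
    nlinarith [Nat.zero_le (E.n * (lastLevel A K).cost), Nat.zero_le (level A K).cost]
  · exact fun τ h => ⟨h.2.2.1, h.2.2.2⟩

end NFold

namespace NFold

variable {r s t K : ℕ}

/-! ### Reading off an optimal path -/

/-- `S` starts with `i` steps that follow the tables. -/
def Env.Follows (E : Env t K) (A : Bimatrix r s t) (γ : ℤ) (V C : (Fin t → ℤ) → ℤ → ℤ) (i : ℕ)
    (S : ℕ → Fin t → ℤ) : Prop :=
  S 0 = 0 ∧ (∀ k < i, E.Step A γ k (S k) (S (k + 1) - S k)) ∧ 1 ≤ C (S i) i ∧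
    ∑ k ∈ Finset.range i, E.gain k (S (k + 1) - S k) + V (S i) i = V 0 0

namespace Env

variable {E : Env t K} {A : Bimatrix r s t} {γ : ℤ} {V C : (Fin t → ℤ) → ℤ → ℤ}
  {S : ℕ → Fin t → ℤ} {i : ℕ}

theorem Follows.mem_box (h : E.Follows A γ V C i S) : S i ∈ box t K := by
  cases i with
  | zero => rw [h.1]; exact zero_mem_box t K
  | succ i => simpa using (mem_moves.1 (h.2.1 i (Nat.lt_succ_self i)).1).2.2

theorem TableOK.one_le_code (hT : E.TableOK A γ V C 0) : 1 ≤ C 0 0 :=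
  (hT.le_pathCost (E.isPath_zero A γ)).1

theorem TableOK.follows_zero (hT : E.TableOK A γ V C 0) : E.Follows A γ V C 0 0 :=
  ⟨rfl, by simp, by simpa using hT.one_le_code, by simp⟩

/-- Cost so far plus tabulated remaining value is preserved by a step along the stored code. At the
last position the remaining value is `0`, so the path has the value tabulated at the start. -/
theorem Follows.exists_succ (hT : E.TableOK A γ V C 0) (hi : i < E.n)
    (h : E.Follows A γ V C i S) :
    ∃ z ∈ moves A K (S i), C (S i) i = Encodable.encode z + 1 ∧
      E.Follows A γ V C (i + 1) (Function.update S (i + 1) (S i + z)) := by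
  rcases hT.2 i (Nat.zero_le i) hi (S i) h.mem_box with ⟨h1, _⟩ | ⟨z, hz, hC, h1, h2, -⟩
  · have := h.2.2.1
    omega
  have hold : ∀ k ≤ i, Function.update S (i + 1) (S i + z) k = S k := fun k hk =>
    Function.update_of_ne (by omega) _ _
  have hnew : Function.update S (i + 1) (S i + z) (i + 1) = S i + z := Function.update_self ..
  refine ⟨z, hz.1, h1, ?_, fun k hk => ?_, ?_, ?_⟩
  · rw [hold 0 (Nat.zero_le i), h.1]
  · rcases Nat.lt_succ_iff_lt_or_eq.1 hk with hk | rfl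
    · rw [hold k hk.le, hold (k + 1) hk]
      exact h.2.1 k hk
    · rw [hold k le_rfl, hnew, add_sub_cancel_left]
      exact hz
  · rw [hnew]
    exact_mod_cast hC
  · rw [Finset.sum_range_succ, hnew, hold i le_rfl, add_sub_cancel_left, ← h.2.2.2, h2]
    rw [Finset.sum_congr rfl fun k hk => by
      rw [hold k (Finset.mem_range.1 hk).le, hold (k + 1) (Finset.mem_range.1 hk)]]
    push_cast
    ring

theorem Follows.isPath (hT : E.TableOK A γ V C 0) (h : E.Follows A γ V C E.n S) :
    E.IsPath A γ S ∧ E.pathCost S = V 0 0 := by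
  obtain ⟨h1, h2⟩ := hT.1 (S E.n) h.mem_box
  have h3 := h.2.2.1
  have h4 := h.2.2.2
  refine ⟨⟨h.1, h.2.1, ?_⟩, ?_⟩
  · by_contra h0
    rw [h2, if_neg h0] at h3
    omega
  · rw [h1, add_zero] at h4
    exact h4

/-- During the search for the step size only the optimal value is computed; that it is attained
needs no run of `walk`. -/
theorem TableOK.exists_path (hT : E.TableOK A γ V C 0) :
    ∃ S, E.IsPath A γ S ∧ E.pathCost S = V 0 0 := by
  have : ∀ i ≤ E.n, ∃ S, E.Follows A γ V C i S := by
    intro i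
    induction i with
    | zero => exact fun _ => ⟨0, hT.follows_zero⟩
    | succ i ih =>
      intro hi
      obtain ⟨S, hS⟩ := ih (by omega)
      obtain ⟨z, -, -, h⟩ := hS.exists_succ hT hi
      exact ⟨_, h⟩
  obtain ⟨S, hS⟩ := this E.n le_rfl
  exact ⟨S, hS.isPath hT⟩

end Env

/-- Writes the brick `z` and moves on from the partial sum `σ`. -/
def emit (σ z : Fin t → ℤ) : Prog :=
  Prog.seq (forEach (List.finRange t) fun j => Prog.store 5 (addr 3 j) (Expr.const (z j)))
    (Prog.seq (Prog.assign 6 (Expr.const (Encodable.encode (σ + z)))) (Prog.assign 3 next))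

/-- An array number is part of the program and cannot be computed, so the current partial sum, kept
in register `6` by its code, is found by a case distinction over the finite box. The same is done
for the brick. -/
noncomputable def walkStep (A : Bimatrix r s t) (K : ℕ) : Prog :=
  switch (box t K) (fun σ => Test.eq (Expr.reg 6) (Expr.const (Encodable.encode σ))) fun σ =>
    switch (moves A K σ) (fun z => Test.eq (Expr.cell (codeArr σ) (Expr.reg 3))
      (Expr.const (Encodable.encode z + 1))) (emit σ)

/-- Follows the tables and writes the bricks to the output. -/
noncomputable def walk (A : Bimatrix r s t) (K : ℕ) : Prog :=
  Prog.seq (Prog.assign 6 (Expr.const (Encodable.encode (0 : Fin t → ℤ))))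
    (Prog.seq (Prog.assign 3 (Expr.const 0))
      (Prog.loop (Test.le next (Expr.reg 0)) (walkStep A K)))

theorem walkStep_loopFree (A : Bimatrix r s t) (K : ℕ) : (walkStep A K).LoopFree :=
  switch_loopFree fun _ => switch_loopFree fun _ => ⟨forEach_loopFree fun _ => trivial,
    trivial, trivial⟩

/-- Uniqueness of division by `t` with remainder; distinct coordinates have distinct addresses. -/
theorem mul_add_inj {i k : ℕ} {j j' : Fin t} (h : (i : ℤ) * t + (j : ℕ) = k * t + (j' : ℕ)) :
    i = k ∧ j = j' := by
  have h' : t * i + j = t * k + j' := by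
    rw [mul_comm t, mul_comm t]
    exact_mod_cast h
  have ht : 0 < t := j.pos
  have hik : i = k := by
    have := congrArg (· / t) h'
    simpa [Nat.mul_add_div ht, Nat.div_eq_of_lt j.2, Nat.div_eq_of_lt j'.2] using this
  subst hik
  exact ⟨rfl, Fin.ext (by omega)⟩

theorem emit_wp (E : Env t K) {s₀ : State} {i : ℕ} (h3 : s₀.reg 3 = i) (hi : i < E.n)
    {σ z : Fin t → ℤ} (hz : z ∈ box t K) (hσ : σ + z ∈ box t K) :
    WP E.B (emit σ z) s₀ fun τ => Frame (fun k => k = 3 ∨ k = 6) (fun a _ => a = 5) s₀ τ ∧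
      τ.reg 3 = i + 1 ∧ τ.reg 6 = Encodable.encode (σ + z) ∧
        (∀ k < i, ∀ j : Fin t, τ.arr 5 (k * t + j) = s₀.arr 5 (k * t + j)) ∧
          ∀ j : Fin t, τ.arr 5 (i * t + j) = z j := by
  have hDB : E.D ≤ E.B := by linarith [E.four_mul_le_B, E.D_le_MD, E.MD_nonneg]
  refine WP.seq ((WP.forEach_and (fun τ => Frame (fun _ => False) (fun a _ => a = 5) s₀ τ ∧
    ∀ k < i, ∀ j : Fin t, τ.arr 5 (k * t + j) = s₀.arr 5 (k * t + j))
    (fun (j : Fin t) τ => τ.arr 5 (i * t + j) = z j) (fun j _ τ hτ => ?_)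
    ⟨Frame.refl _ _ _, fun _ _ _ => rfl⟩).mono fun τ hτ => ?_)
  · have h3τ : τ.reg 3 = i := (hτ.1.1 3 (by simp)).trans h3
    refine WP.store (addr_fits E h3τ hi j) (((mem_box.1 hz j).trans E.K_le).trans hDB)
      ⟨⟨hτ.1.setCell rfl _, fun k hk j' => ?_⟩, ?_, fun j' _ hj' h => ?_⟩
    · rw [State.setCell_arr, if_neg, hτ.2 k hk j']
      rintro ⟨-, h⟩
      rw [addr_eval, h3τ] at h
      exact hk.ne (mul_add_inj h).1
    · simp [addr_eval, h3τ, Expr.eval]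
    · rw [State.setCell_arr, if_neg, h]
      rintro ⟨-, h⟩
      rw [addr_eval, h3τ] at h
      exact hj' (mul_add_inj h).2
  · obtain ⟨⟨hF, hold⟩, hnew⟩ := hτ
    have h3τ : τ.reg 3 = i := (hF.1 3 (by simp)).trans h3
    refine WP.seq (WP.assign ?_ (WP.assign (next_fits E (i := i) (by simpa using h3τ) hi) ?_))
    · change |((Encodable.encode (σ + z) : ℕ) : ℤ)| ≤ E.B
      rw [abs_of_nonneg (by positivity)]
      linarith [E.code_le _ hσ]
    · refine ⟨((hF.mono (fun _ h => h.elim) fun _ _ => id).setReg (Or.inr rfl) _).setReg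
        (Or.inl rfl) _, ?_, ?_, hold, fun j => hnew j (List.mem_finRange j)⟩
      · simp [next, Expr.eval, Op.eval, h3τ]
      · simp [Expr.eval]

theorem walk_twp (E : Env t K) {A : Bimatrix r s t} {s₀ : State} (hs : E.Loaded s₀) {γ : ℤ}
    (hT : E.TableOK A γ s₀.val s₀.code 0) :
    TWP E.B (walk A K) s₀ (((walkStep A K).cost + 13) * (E.n + 1)) fun τ =>
      τ.reg 1 = s₀.reg 1 ∧ ∃ S, E.IsPath A γ S ∧ E.pathCost S = s₀.val (0 : Fin t → ℤ) 0 ∧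
        ∀ k < E.n, ∀ j : Fin t, τ.arr 5 (k * t + j) = (S (k + 1) - S k) j := by
  let I : ℕ → State → Prop := fun m τ => ∃ i, i + m = E.n ∧ τ.reg 3 = i ∧
    Frame (fun k => k = 3 ∨ k = 6) (fun a _ => a = 5) s₀ τ ∧
      ∃ S, E.Follows A γ s₀.val s₀.code i S ∧ τ.reg 6 = Encodable.encode (S i) ∧
        ∀ k < i, ∀ j : Fin t, τ.arr 5 (k * t + j) = (S (k + 1) - S k) j
  have hDB : E.D ≤ E.B := by linarith [E.four_mul_le_B, E.D_le_MD, E.MD_nonneg]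
  have hcode : ∀ z ∈ box t K, |((Encodable.encode z : ℕ) : ℤ)| ≤ E.B ∧
      |((Encodable.encode z : ℕ) : ℤ) + 1| ≤ E.B := fun z hz => by
    have := E.code_le z hz
    rw [abs_of_nonneg (by positivity), abs_of_nonneg (by positivity)]
    omega
  have hB := one_le_B E
  have htest : ∀ m τ, I m τ → (Test.le next (Expr.reg 0)).Fits E.B τ ∧
      ((Test.le next (Expr.reg 0)).Holds τ ↔ m ≠ 0) := by
    rintro m τ ⟨i, him, h3, hF, -⟩
    have h0 : τ.reg 0 = E.n := (hF.1 0 (by norm_num)).trans hs.n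
    constructor
    · refine ⟨⟨abs_reg_le_B E h3 (by omega), by simpa [Expr.Fits] using hB, ?_⟩,
        abs_reg_le_B E h0 le_rfl⟩
      have h2 := E.four_mul_le_B
      have h4 := E.M_le_MD
      have h5 := E.one_le_M
      have h6 := E.n_le
      simp only [Expr.eval, Op.eval, h3, abs_le]
      constructor <;> linarith
    · simp only [Test.Holds, next, Expr.eval, Op.eval, h3, h0]
      omega
  have hbody : ∀ m τ, I (m + 1) τ → TWP E.B (walkStep A K) τ (walkStep A K).cost (I m) := by
    rintro m τ ⟨i, him, h3, hF, S, hS, h6, hout⟩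
    have hi : i < E.n := by omega
    obtain ⟨z, hz, hC, hS'⟩ := hS.exists_succ hT hi
    have hzb := mem_moves.1 hz
    have h3B := abs_reg_le_B E h3 hi.le
    have hcell : ∀ ρ : Fin t → ℤ, τ.arr (codeArr ρ) (τ.reg 3) = s₀.code ρ i := fun ρ => by
      rw [h3]
      exact hF.2 _ _ (by unfold codeArr; omega)
    refine WP.timed (WP.switch (a := S i) hS.mem_box (fun b hb => ⟨?_, (hcode b hb).1⟩)
      (fun b _ => ?_) (WP.switch (a := z) hz (fun b hb => ⟨⟨h3B, ?_⟩,
        (hcode b (mem_moves.1 hb).1).2⟩) (fun b _ => ?_)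
        ((emit_wp E h3 hi hzb.1 hzb.2.2).mono ?_))) (walkStep_loopFree A K)
    · change |τ.reg 6| ≤ E.B
      rw [h6]
      exact (hcode _ hS.mem_box).1
    · simp only [Test.Holds, Expr.eval, h6, Nat.cast_inj, Encodable.encode_inj]
      exact eq_comm
    · change |τ.arr (codeArr (S i)) (τ.reg 3)| ≤ E.B
      rw [hcell, hC]
      exact (hcode _ hzb.1).2
    · change τ.arr (codeArr (S i)) (τ.reg 3) = _ ↔ _
      rw [hcell, hC]
      simp only [Expr.eval, add_left_inj, Nat.cast_inj, Encodable.encode_inj]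
      exact eq_comm
    · rintro υ ⟨hF', h3', h6', hold, hnew⟩
      refine ⟨i + 1, by omega, by simpa using h3',
        hF.trans hF' (fun _ => id) (fun _ => id) (fun _ _ => id) (fun _ _ => id), _, hS', ?_, ?_⟩
      · rw [h6', Function.update_self]
      · intro k hk j
        rcases Nat.lt_succ_iff_lt_or_eq.1 hk with hk | rfl
        · rw [hold k hk, hout k hk, Function.update_of_ne (by omega),
            Function.update_of_ne (by omega)]
        · rw [hnew, Function.update_self, Function.update_of_ne (by omega), add_sub_cancel_left]
  refine TWP.mono (TWP.seq (TWP.assign (hcode 0 (zero_mem_box t K)).1 (TWP.seq (TWP.assign ?_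
    (TWP.loop I (fun m τ h => (htest m τ h).1) (fun m τ h => (htest m τ h).2) hbody E.n ?_)))))
    ?_ ?_
  · simpa [Expr.Fits] using zero_le_one.trans hB
  · refine ⟨0, by simp, by simp [Expr.eval], ((Frame.refl _ _ _).setReg (Or.inr rfl) _).setReg
      (Or.inl rfl) _, 0, hT.follows_zero, by simp [Expr.eval], by simp⟩
  · simp only [Expr.cost, Test.cost, next]
    nlinarith [Nat.zero_le (walkStep A K).cost]
  · rintro τ ⟨i, hi, -, hF, S, hS, -, hout⟩
    obtain rfl : i = E.n := by omega
    exact ⟨hF.1 1 (by norm_num), S, (hS.isPath hT).1, (hS.isPath hT).2, hout⟩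

/-! ### The search for the step size -/

/-- The largest step sizes that are allowed by the upper and by the lower bound of coordinate `j`
of brick `i` if the direction has absolute value `k` there. -/
def Env.upSize (E : Env t K) (i : ℕ) (j : Fin t) (k : ℕ) : ℤ :=
  (E.u (i * t + j) - E.x (i * t + j)) / k

def Env.downSize (E : Env t K) (i : ℕ) (j : Fin t) (k : ℕ) : ℤ :=
  (E.x (i * t + j) - E.l (i * t + j)) / k

def sizeExpr (a a' : ℕ) (j : Fin t) (k : ℕ) : Expr :=
  Expr.op Op.div (Expr.op Op.sub (Expr.cell a (addr 2 j)) (Expr.cell a' (addr 2 j)))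
    (Expr.const k)

/-- Tries the step size `e`; the best step size so far and its value are in registers `4`
and `5`. -/
noncomputable def trySize (A : Bimatrix r s t) (K : ℕ) (e : Expr) : Prog :=
  Prog.seq (Prog.assign 1 e) (Prog.ite (Test.le (Expr.const 1) (Expr.reg 1))
    (Prog.seq (tables A K) (Prog.seq
      (Prog.assign 7 (Expr.op Op.mul (Expr.reg 1) (Expr.cell (valArr (0 : Fin t → ℤ)) (Expr.const 0))))
      (Prog.ite (Test.le (Expr.reg 7) (Expr.reg 5))
        (Prog.seq (Prog.assign 4 (Expr.reg 1)) (Prog.assign 5 (Expr.reg 7))) Prog.skip)))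
    Prog.skip)

/-- The step size in register `4` attains the value in register `5`. -/
def Env.Best (E : Env t K) (A : Bimatrix r s t) (τ : State) : Prop :=
  1 ≤ τ.reg 4 ∧ τ.reg 4 ≤ 2 * E.M ∧ |τ.reg 5| ≤ E.B ∧ τ.reg 5 ≤ 0 ∧
    ∃ S, E.IsPath A (τ.reg 4) S ∧ τ.reg 4 * E.pathCost S ≤ τ.reg 5

/-- No direction with step size `γ` has a value below `v`. -/
def Env.Beats (E : Env t K) (A : Bimatrix r s t) (v γ : ℤ) : Prop :=
  1 ≤ γ → ∀ S, E.IsPath A γ S → v ≤ γ * E.pathCost S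

theorem Env.Beats.mono {E : Env t K} {A : Bimatrix r s t} {v v' γ : ℤ} (h : E.Beats A v γ)
    (hv : v' ≤ v) : E.Beats A v' γ := fun hγ S hS => hv.trans (h hγ S hS)

/-- The tables give the optimum for this step size, and multiplying by the positive step size
preserves comparisons. A candidate below `1` is skipped, which is harmless because `Beats` then
asserts nothing. -/
theorem trySize_twp (E : Env t K) {A : Bimatrix r s t} {s₀ : State} (hs : E.Loaded s₀)
    (hbest : E.Best A s₀) {e : Expr} (he : e.Fits E.B s₀) (he' : e.eval s₀ ≤ 2 * E.M) :
    TWP E.B (trySize A K e) s₀ ((e.cost + tablesCost A K + 22) * (E.n + 1)) fun τ =>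
      Frame (fun k => k ≠ 0 ∧ k ≠ 2) (fun a _ => 6 ≤ a) s₀ τ ∧ E.Best A τ ∧
        τ.reg 5 ≤ s₀.reg 5 ∧ E.Beats A (τ.reg 5) (e.eval s₀) := by
  have hB := one_le_B E
  set γ := e.eval s₀ with hγdef
  refine TWP.mono (TWP.seq (TWP.assign he (TWP.ite (k := tablesCost A K * (E.n + 1) + 15) (k' := 1)
    ⟨by simpa [Expr.Fits] using hB, ?_⟩ (fun h1 => ?_) fun h1 => TWP.skip ?_)))
    ?_ fun _ => id
  · change |(s₀.setReg 1 γ).reg 1| ≤ E.B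
    -- In each form of an expression, `Fits` includes the bound for its own value.
    have hev : ∀ (e : Expr), e.Fits E.B s₀ → |e.eval s₀| ≤ E.B := fun e he => by
      cases e with
      | const z => exact he
      | reg k => exact he
      | cell a i => exact he.2
      | op o a b => exact he.2.2
    simpa using hev e he
  · have h1' : 1 ≤ γ := by simpa [Test.Holds, Expr.eval] using h1
    set s₁ := s₀.setReg 1 γ
    have hF : Frame (fun k => k ≠ 0 ∧ k ≠ 2) (fun a _ => 6 ≤ a) s₀ s₁ :=
      (Frame.refl _ _ _).setReg (by norm_num) _
    have hL : E.Loaded s₁ := hs.frame hF (by norm_num) fun a i h => by omega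
    have hr1 : s₁.reg 1 = γ := by simp [s₁]
    refine TWP.mono (TWP.seq (c' := 15) ((tables_twp E (A := A) hL (hr1 ▸ h1') (hr1 ▸ he')).mono
      le_rfl fun τ hτ => ?_)) le_rfl fun _ => id
    obtain ⟨hF', hT⟩ := hτ
    rw [hr1] at hT
    have hr : ∀ k, k ≠ 3 → k ≠ 7 → k ≠ 1 → τ.reg k = s₀.reg k := fun k h3 h7 h1 => by
      rw [hF'.1 k (by tauto)]
      simp [s₁, h1]
    have h1τ : τ.reg 1 = γ := (hF'.1 1 (by norm_num)).trans hr1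
    have hFτ : Frame (fun k => k ≠ 0 ∧ k ≠ 2) (fun a _ => 6 ≤ a) s₀ τ :=
      hF.trans hF' (fun _ => id) (fun _ h => by omega) (fun _ _ => id) (fun _ _ => id)
    have hγB : |γ| ≤ 2 * E.M := abs_le.2 ⟨by linarith, he'⟩
    have hV : |τ.val (0 : Fin t → ℤ) 0| ≤ E.n * E.brickBound := by
      simpa using hT.abs_value_le (Nat.zero_le _) (zero_mem_box t K)
        (by simpa using hT.one_le_code)
    have hprod : |γ * τ.val (0 : Fin t → ℤ) 0| ≤ E.B := by
      rw [abs_mul]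
      refine (mul_le_mul hγB hV (abs_nonneg _) ?_).trans E.size_mul_value_le_B
      linarith [E.one_le_M]
    have hγB' : |γ| ≤ E.B := by
      linarith [E.four_mul_le_B, E.M_le_MD, E.MD_nonneg]
    have heval : (Expr.op Op.mul (Expr.reg 1) (Expr.cell (valArr (0 : Fin t → ℤ))
        (Expr.const 0))).eval τ = γ * τ.val (0 : Fin t → ℤ) 0 := by
      simp [Expr.eval, Op.eval, h1τ, State.val]
    have hzero : (0 : ℤ) ≤ E.B := by linarith
    have hbeats : E.Beats A (γ * τ.val (0 : Fin t → ℤ) 0) γ := fun _ S hS =>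
      mul_le_mul_of_nonneg_left (hT.le_pathCost hS).2 (by linarith)
    have hval0 : τ.arr (valArr (0 : Fin t → ℤ)) 0 = τ.val (0 : Fin t → ℤ) 0 := rfl
    refine TWP.mono (c := 5 + (3 + (4 + 1))) (TWP.seq (TWP.mono (TWP.assign ?_ ?_) le_rfl
      fun _ => id)) (by norm_num) fun _ => id
    · refine ⟨by simpa [Expr.Fits, h1τ] using hγB', ⟨by simpa [Expr.Fits] using hzero, ?_⟩, ?_⟩
      · simp only [Expr.eval]
        rw [hval0]
        refine hV.trans E.value_le_B
      · have := heval
        simp only [Expr.eval] at this ⊢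
        rw [this]
        exact hprod
    · rw [heval]
      set τ' := τ.setReg 7 (γ * τ.val (0 : Fin t → ℤ) 0)
      have h7 : τ'.reg 7 = γ * τ.val (0 : Fin t → ℤ) 0 := by simp [τ']
      have h5 : τ'.reg 5 = s₀.reg 5 := by simp [τ', hr]
      have h4 : τ'.reg 4 = s₀.reg 4 := by simp [τ', hr]
      have h1'' : τ'.reg 1 = γ := by simp [τ', h1τ]
      have hF'' : Frame (fun k => k ≠ 0 ∧ k ≠ 2) (fun a _ => 6 ≤ a) s₀ τ' :=
        hFτ.setReg (by norm_num) _
      refine TWP.ite (k := 4) (k' := 1) ⟨?_, ?_⟩ (fun hle => ?_) fun hle => TWP.skip ?_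
      · simpa [Expr.Fits, h7] using hprod
      · simpa [Expr.Fits, h5] using hbest.2.2.1
      · have hle' : γ * τ.val (0 : Fin t → ℤ) 0 ≤ s₀.reg 5 := by
          rw [← h7, ← h5]
          exact hle
        refine TWP.mono (c := 2 + 2) (TWP.seq (TWP.assign ?_ (TWP.assign ?_ ?_))) le_rfl fun _ => id
        · simpa [Expr.Fits, h1''] using hγB'
        · simpa [Expr.Fits, h7] using hprod
        · refine ⟨(hF''.setReg (by norm_num) _).setReg (by norm_num) _, ?_, ?_, ?_⟩
          · obtain ⟨S, hS, hSV⟩ := hT.exists_path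
            refine ⟨?_, ?_, ?_, ?_, S, ?_⟩
            · simpa [Expr.eval, h1''] using h1'
            · simpa [Expr.eval, h1''] using he'
            · simpa [Expr.eval, h7] using hprod
            · simpa [Expr.eval, h7] using hle'.trans hbest.2.2.2.1
            · simpa [Expr.eval, h7, h1'', hSV] using hS
          · simpa [Expr.eval, h7] using hle'
          · simpa [Expr.eval, h7] using hbeats
      · have hlt : s₀.reg 5 ≤ γ * τ.val (0 : Fin t → ℤ) 0 := by
          rw [← h7, ← h5]
          exact (not_le.1 hle).le
        refine ⟨hF'', ?_, h5.le, ?_⟩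
        · simpa only [Env.Best, h4, h5] using hbest
        · rw [h5]
          exact hbeats.mono hlt
  · have h1' : ¬ 1 ≤ γ := by simpa [Test.Holds, Expr.eval] using h1
    refine ⟨(Frame.refl _ _ _).setReg (by norm_num) _, ?_, ?_, fun h => absurd h h1'⟩
    · simpa [Env.Best] using hbest
    · simp
  · simp only [Test.cost, Expr.cost]
    nlinarith [Nat.zero_le (e.cost * E.n), Nat.zero_le E.n]

end NFold

/-! ### The complete search and its running time -/

namespace NFold

variable {r s t K : ℕ}

/-- A slack is a difference of two numbers of absolute value at most `M`, and dividing a nonnegative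
number by `k` does not enlarge it; this is the source of the bound `2 M` for step sizes. -/
theorem sizeExpr_fits (E : Env t K) {τ : State} {i : ℕ} (h2 : τ.reg 2 = i) (hi : i < E.n)
    {a a' : ℕ} {j : Fin t} {k : ℕ} (hk : k ≤ K) (ha : |τ.arr a (i * t + (j : ℕ))| ≤ E.M)
    (ha' : |τ.arr a' (i * t + (j : ℕ))| ≤ E.M)
    (hle : τ.arr a' (i * t + (j : ℕ)) ≤ τ.arr a (i * t + (j : ℕ))) :
    (sizeExpr a a' j k).Fits E.B τ ∧ (sizeExpr a a' j k).eval τ ≤ 2 * E.M := by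
  have hB := E.four_mul_le_B
  have hM := E.M_le_MD
  have hD := E.D_le_MD
  have h0 := E.MD_nonneg
  have hk' : (k : ℤ) ≤ E.D := le_trans (by exact_mod_cast hk) E.K_le
  rw [abs_le] at ha ha'
  have hnn : 0 ≤ τ.arr a (i * t + (j : ℕ)) - τ.arr a' (i * t + (j : ℕ)) := by linarith
  have hdiv := Int.ediv_le_self (k : ℤ) hnn
  have hdiv0 := Int.ediv_nonneg hnn (Nat.cast_nonneg k)
  have haddr := addr_fits E h2 hi j
  simp only [sizeExpr, Expr.Fits, Expr.eval, Op.eval, addr_eval, h2, abs_le]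
  refine ⟨⟨⟨⟨haddr, ?_⟩, ⟨haddr, ?_⟩, ?_⟩, ?_, ?_⟩, ?_⟩
  all_goals first | linarith | (constructor <;> linarith)

/-- Tries all step sizes that are determined by the brick whose position is in register `2`. -/
noncomputable def tryBrick (A : Bimatrix r s t) (K : ℕ) : Prog :=
  forEach (List.finRange t ×ˢ List.range K) fun p =>
    Prog.seq (trySize A K (sizeExpr 3 4 p.1 (p.2 + 1))) (trySize A K (sizeExpr 4 2 p.1 (p.2 + 1)))

noncomputable def tryBrickCost (A : Bimatrix r s t) (K : ℕ) : ℕ :=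
  (List.finRange t ×ˢ List.range K).length * (2 * (tablesCost A K + 37)) + 1

theorem tryBrick_twp (E : Env t K) {A : Bimatrix r s t} {s₀ : State} (hs : E.Loaded s₀)
    (hbest : E.Best A s₀) {i : ℕ} (h2 : s₀.reg 2 = i) (hi : i < E.n) :
    TWP E.B (tryBrick A K) s₀ (tryBrickCost A K * (E.n + 1)) fun τ =>
      Frame (fun k => k ≠ 0 ∧ k ≠ 2) (fun a _ => 6 ≤ a) s₀ τ ∧ E.Best A τ ∧
        τ.reg 5 ≤ s₀.reg 5 ∧ ∀ j, ∀ k < K, E.Beats A (τ.reg 5) (E.upSize i j (k + 1 : ℕ)) ∧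
          E.Beats A (τ.reg 5) (E.downSize i j (k + 1 : ℕ)) := by
  let I : List (Fin t × ℕ) → State → Prop := fun pre τ =>
    Frame (fun k => k ≠ 0 ∧ k ≠ 2) (fun a _ => 6 ≤ a) s₀ τ ∧ E.Best A τ ∧ τ.reg 5 ≤ s₀.reg 5 ∧
      ∀ p ∈ pre, E.Beats A (τ.reg 5) (E.upSize i p.1 (p.2 + 1 : ℕ)) ∧
        E.Beats A (τ.reg 5) (E.downSize i p.1 (p.2 + 1 : ℕ))
  refine (TWP.forEach (c := 2 * (tablesCost A K + 37) * (E.n + 1)) I ?_ []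
    ⟨Frame.refl _ _ _, hbest, le_rfl, by simp⟩).mono ?_ fun τ hτ =>
      ⟨hτ.1, hτ.2.1, hτ.2.2.1, fun j k hk => hτ.2.2.2 (j, k) (by simp [hk])⟩
  · rintro pre ⟨j, k⟩ hp τ ⟨hF, hb, hle, hpre⟩
    have hk : k + 1 ≤ K := by simpa using hp
    have hload : ∀ {υ}, Frame (fun k => k ≠ 0 ∧ k ≠ 2) (fun a _ => 6 ≤ a) s₀ υ → E.Loaded υ :=
      fun hF => hs.frame hF (by norm_num) fun a i h => by omega
    have hreg : ∀ {υ}, Frame (fun k => k ≠ 0 ∧ k ≠ 2) (fun a _ => 6 ≤ a) s₀ υ → υ.reg 2 = i :=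
      fun hF => (hF.1 2 (by norm_num)).trans h2
    have hL := hload hF
    have hup := sizeExpr_fits E (hreg hF) hi (a := 3) (a' := 4) (j := j) hk
      (by rw [hL.u]; exact E.abs_u i hi j) (by rw [hL.x]; exact E.abs_x hi j)
      (by rw [hL.u, hL.x]; exact E.x_le_u i hi j)
    refine TWP.mono (TWP.seq ((trySize_twp E hL hb hup.1 hup.2).mono le_rfl fun υ hυ => ?_))
      -- Evaluating `sizeExpr` costs `15` steps, which gives the constant `37` in `tryBrickCost`.
      (c := (15 + tablesCost A K + 22) * (E.n + 1) + (15 + tablesCost A K + 22) * (E.n + 1))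
      (by ring_nf; exact le_rfl) fun _ => id
    obtain ⟨hF', hb', hle', hbeat⟩ := hυ
    have hFυ : Frame (fun k => k ≠ 0 ∧ k ≠ 2) (fun a _ => 6 ≤ a) s₀ υ :=
      hF.trans hF' (fun _ => id) (fun _ => id) (fun _ _ => id) (fun _ _ => id)
    have hLυ := hload hFυ
    have hdown := sizeExpr_fits E (hreg hFυ) hi (a := 4) (a' := 2) (j := j) hk
      (by rw [hLυ.x]; exact E.abs_x hi j) (by rw [hLυ.l]; exact E.abs_l i hi j)
      (by rw [hLυ.l, hLυ.x]; exact E.l_le_x i hi j)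
    refine (trySize_twp E hLυ hb' hdown.1 hdown.2).mono le_rfl fun ω hω => ?_
    obtain ⟨hF'', hb'', hle'', hbeat'⟩ := hω
    have hupv : (sizeExpr 3 4 j (k + 1)).eval τ = E.upSize i j (k + 1 : ℕ) := by
      simp [sizeExpr, Expr.eval, Op.eval, addr_eval, hreg hF, hL.u, hL.x, Env.upSize]
    have hdownv : (sizeExpr 4 2 j (k + 1)).eval υ = E.downSize i j (k + 1 : ℕ) := by
      simp [sizeExpr, Expr.eval, Op.eval, addr_eval, hreg hFυ, hLυ.l, hLυ.x, Env.downSize]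
    rw [hupv] at hbeat
    rw [hdownv] at hbeat'
    refine ⟨hFυ.trans hF'' (fun _ => id) (fun _ => id) (fun _ _ => id) (fun _ _ => id), hb'',
      hle''.trans (hle'.trans hle), fun p hp => ?_⟩
    rcases List.mem_cons.1 hp with rfl | hp
    · exact ⟨hbeat.mono hle'', hbeat'⟩
    · exact ⟨(hpre p hp).1.mono (hle''.trans hle'), (hpre p hp).2.mono (hle''.trans hle')⟩
  · rw [tryBrickCost, add_mul, ← mul_assoc]
    omega

/-- The algorithm: searches for the best step size, and computes a best direction for it. -/
noncomputable def graverBest (A : Bimatrix r s t) (K : ℕ) : Prog :=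
  Prog.seq (Prog.assign 4 (Expr.const 1)) (Prog.seq (Prog.assign 5 (Expr.const 0))
    (Prog.seq (Prog.assign 2 (Expr.reg 0)) (Prog.seq
      (Prog.loop (Test.le (Expr.const 1) (Expr.reg 2))
        (Prog.seq (Prog.assign 2 (Expr.op Op.sub (Expr.reg 2) (Expr.const 1))) (tryBrick A K)))
      (Prog.seq (Prog.assign 1 (Expr.reg 4)) (Prog.seq (tables A K) (walk A K))))))

noncomputable def graverBestCost (A : Bimatrix r s t) (K : ℕ) : ℕ :=
  tryBrickCost A K + tablesCost A K + (walkStep A K).cost + 40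

theorem graverBest_twp (E : Env t K) (A : Bimatrix r s t) {s₀ : State} (hs : E.Loaded s₀) :
    TWP E.B (graverBest A K) s₀ (graverBestCost A K * (E.n + 1) ^ 2) fun τ =>
      1 ≤ τ.reg 1 ∧ ∃ S, E.IsPath A (τ.reg 1) S ∧ τ.reg 1 * E.pathCost S ≤ 0 ∧
        (∀ i < E.n, ∀ j : Fin t, τ.arr 5 (i * t + j) = (S (i + 1) - S i) j) ∧
          ∀ i < E.n, ∀ j, ∀ k < K,
            E.Beats A (τ.reg 1 * E.pathCost S) (E.upSize i j (k + 1 : ℕ)) ∧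
              E.Beats A (τ.reg 1 * E.pathCost S) (E.downSize i j (k + 1 : ℕ)) := by
  have hB := one_le_B E
  have hM := E.one_le_M
  have hload : ∀ {υ}, Frame (fun k => k ≠ 0) (fun a _ => 6 ≤ a) s₀ υ → E.Loaded υ :=
    fun hF => hs.frame hF (by norm_num) fun a i h => by omega
  -- Bricks are searched from the last to the first: those at positions from `m` on are done.
  -- Earlier comparisons survive because the best value never increases.
  let I : ℕ → State → Prop := fun m τ => m ≤ E.n ∧ τ.reg 2 = m ∧
    Frame (fun k => k ≠ 0) (fun a _ => 6 ≤ a) s₀ τ ∧ E.Best A τ ∧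
      ∀ i, m ≤ i → i < E.n → ∀ j, ∀ k < K, E.Beats A (τ.reg 5) (E.upSize i j (k + 1 : ℕ)) ∧
        E.Beats A (τ.reg 5) (E.downSize i j (k + 1 : ℕ))
  have hbody : ∀ m τ, I (m + 1) τ → TWP E.B
      (Prog.seq (Prog.assign 2 (Expr.op Op.sub (Expr.reg 2) (Expr.const 1))) (tryBrick A K)) τ
      (4 + tryBrickCost A K * (E.n + 1)) (I m) := by
    rintro m τ ⟨hm, h2, hF, hb, hbeat⟩
    refine TWP.seq (TWP.assign ((countdown_fits E h2 hm).2.2 (Nat.succ_pos m)) ?_)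
    set τ' := τ.setReg 2 ((Expr.op Op.sub (Expr.reg 2) (Expr.const 1)).eval τ)
    have h2' : τ'.reg 2 = m := by simp [τ', Expr.eval, Op.eval, h2]
    have hF' : Frame (fun k => k ≠ 0) (fun a _ => 6 ≤ a) s₀ τ' := hF.setReg (by norm_num) _
    have hb' : E.Best A τ' := by simpa [Env.Best, τ'] using hb
    have h5 : τ'.reg 5 = τ.reg 5 := by simp [τ']
    refine (tryBrick_twp E (hload hF') hb' h2' hm).mono le_rfl fun υ hυ => ?_
    obtain ⟨hF'', hb'', hle, hnew⟩ := hυ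
    rw [h5] at hle
    refine ⟨by omega, (hF''.1 2 (by norm_num)).trans h2',
      hF'.trans hF'' (fun _ => id) (fun _ h => h.1) (fun _ _ => id) (fun _ _ => id), hb'',
      fun i hmi hi j k hk => ?_⟩
    rcases hmi.eq_or_lt with rfl | hmi
    · exact hnew j k hk
    · exact ⟨(hbeat i hmi hi j k hk).1.mono hle, (hbeat i hmi hi j k hk).2.mono hle⟩
  have h0 : ∀ {υ}, Frame (fun k => k ≠ 0) (fun a _ => 6 ≤ a) s₀ υ → |υ.reg 0| ≤ E.B :=
    fun hF => abs_reg_le_B E (hload hF).n le_rfl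
  refine TWP.mono (TWP.seq (TWP.assign ?_ (TWP.seq (TWP.assign ?_ (TWP.seq (TWP.assign ?_
    (TWP.seq ((TWP.loop I (fun m τ h => (countdown_fits E h.2.1 h.1).1)
      (fun m τ h => (countdown_fits E h.2.1 h.1).2.1) hbody E.n ?_).mono le_rfl
      (fun τ hτ => TWP.seq (c := 2) (c' := tablesCost A K * (E.n + 1) +
        ((walkStep A K).cost + 13) * (E.n + 1)) (TWP.assign ?_ ?_)))))))))) ?_ fun _ => id
  · simpa [Expr.Fits] using hB
  · simpa [Expr.Fits] using zero_le_one.trans hB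
  · exact h0 (((Frame.refl _ _ _).setReg (by norm_num) _).setReg (by norm_num) _)
  · refine ⟨le_rfl, ?_, ((((Frame.refl _ _ _).setReg ?_ _).setReg ?_ _).setReg ?_ _), ?_,
      fun i h1 h2 => absurd h1 (by omega)⟩
    · simp [Expr.eval, hs.n]
    · norm_num
    · norm_num
    · norm_num
    · refine ⟨by simp [Expr.eval], ?_, ?_, by simp [Expr.eval], 0, E.isPath_zero A _, ?_⟩
      · simp only [Expr.eval, State.setReg_reg]
        norm_num
        linarith
      · simpa [Expr.eval] using zero_le_one.trans hB
      · simp [Expr.eval, E.pathCost_zero]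
  · have h4 := E.four_mul_le_B
    have h5 := E.M_le_MD
    have h6 := E.MD_nonneg
    obtain ⟨h7, h8, -⟩ := hτ.2.2.2.1
    simp only [Expr.Fits, abs_le]
    constructor <;> linarith
  · obtain ⟨-, -, hF, ⟨h1, h2, -, h3, S₀, hS₀, hle₀⟩, hbeat⟩ := hτ
    set τ' := τ.setReg 1 ((Expr.reg 4).eval τ)
    have hr1 : τ'.reg 1 = τ.reg 4 := by simp [τ', Expr.eval]
    have hL : E.Loaded τ' := hload (hF.setReg (by norm_num) _)
    refine TWP.seq ((tables_twp E (A := A) hL (hr1 ▸ h1) (hr1 ▸ h2)).mono le_rfl fun υ hυ => ?_)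
    obtain ⟨hF', hT⟩ := hυ
    have hLυ : E.Loaded υ := hL.frame hF' (by norm_num) fun a i h => by omega
    have hυ1 : υ.reg 1 = τ.reg 4 := (hF'.1 1 (by norm_num)).trans hr1
    rw [hr1] at hT
    refine (walk_twp E hLυ hT).mono le_rfl fun ω hω => ?_
    obtain ⟨hω1, S, hS, hSV, hout⟩ := hω
    rw [hω1, hυ1]
    -- The search remembers only a step size and a value. Recomputing the tables for this step size
    -- gives a path `S` at least as good as the path `S₀` that witnesses the value.
    have hle : τ.reg 4 * E.pathCost S ≤ τ.reg 5 := by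
      rw [hSV]
      exact (mul_le_mul_of_nonneg_left (hT.le_pathCost hS₀).2 (by linarith)).trans hle₀
    exact ⟨h1, S, hS, hle.trans h3, hout, fun i hi j k hk =>
      ⟨(hbeat i (Nat.zero_le i) hi j k hk).1.mono hle,
        (hbeat i (Nat.zero_le i) hi j k hk).2.mono hle⟩⟩
  · simp only [graverBestCost, Expr.cost, Test.cost]
    have : (E.n + 1) ≤ (E.n + 1) ^ 2 := Nat.le_self_pow (by norm_num) _
    have h1 := Nat.mul_le_mul_left (tablesCost A K) this
    have h2 := Nat.mul_le_mul_left ((walkStep A K).cost) this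
    have h3 : E.n * (tryBrickCost A K * (E.n + 1)) ≤ tryBrickCost A K * (E.n + 1) ^ 2 := by
      nlinarith [Nat.zero_le (tryBrickCost A K * (E.n + 1))]
    nlinarith

/-! ### Instances -/

theorem colAddr_injective {t n : ℕ} : Function.Injective (colAddr (t := t) (n := n)) := by
  rintro ⟨i, j⟩ ⟨i', j'⟩ h
  obtain ⟨h1, h2⟩ := mul_add_inj h
  exact Prod.ext (Fin.ext h1) h2

theorem extend_colAddr {n : ℕ} (v : Col t n → ℤ) {i : ℕ} (hi : i < n) (j : Fin t) :
    Function.extend colAddr v 0 (i * t + (j : ℕ)) = v (⟨i, hi⟩, j) :=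
  colAddr_injective.extend_apply v 0 (⟨i, hi⟩, j)

theorem abs_le_two_pow_bitLength (z : ℤ) : |z| ≤ 2 ^ bitLength z := by
  have h1 := Nat.lt_size_self z.natAbs
  have h2 : 2 ^ Nat.size z.natAbs ≤ 2 ^ bitLength z :=
    Nat.pow_le_pow_right (by norm_num) (Nat.le_succ _)
  rw [Int.abs_eq_natAbs]
  exact_mod_cast h1.le.trans h2

theorem abs_le_two_pow {ι : Type*} [Fintype ι] (v : ι → ℤ) {L : ℕ} (hL : vecLength v ≤ L) (i : ι) :
    |v i| ≤ 2 ^ L := by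
  refine (abs_le_two_pow_bitLength _).trans (pow_le_pow_right₀ (by norm_num) (le_trans ?_ hL))
  exact Finset.single_le_sum (f := fun i => bitLength (v i)) (fun _ _ => Nat.zero_le _)
    (Finset.mem_univ i)

/-- A bound for the constants of the program. -/
noncomputable def constBound (t K : ℕ) : ℕ :=
  1 + t + K + ((box t K).map fun z => Encodable.encode z + 1).sum

/-- The binary length of the numbers that the program handles. -/
noncomputable def lengthBound (t K : ℕ) : Polynomial ℕ :=
  3 * Polynomial.X + Polynomial.C (4 * constBound t K ^ 2)

section Instance

variable {n : ℕ} (K) (w : Col t n → ℤ) (b : Row r s n → ℤ) (l u x : Col t n → ℤ)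

/-- The input length does not count `x`; feasibility places `x` between `l` and `u`, which bounds
it. -/
noncomputable def Env.ofInstance (hl : l ≤ x) (hu : x ≤ u) : Env t K where
  n := n
  w := Function.extend colAddr w 0
  l := Function.extend colAddr l 0
  u := Function.extend colAddr u 0
  x := Function.extend colAddr x 0
  M := 2 ^ inputLength w b l u
  D := constBound t K
  B := 2 ^ (lengthBound t K).eval (inputLength w b l u)
  one_le_M := one_le_pow₀ (by norm_num)
  one_le_D := by
    have : 1 ≤ constBound t K := by unfold constBound; omega
    exact_mod_cast this
  n_le := by
    have := abs_le_two_pow_bitLength (n : ℤ)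
    rw [abs_of_nonneg (Nat.cast_nonneg n)] at this
    exact this.trans (pow_le_pow_right₀ (by norm_num) (by unfold inputLength; omega))
  t_le := by
    have : t ≤ constBound t K := by unfold constBound; omega
    exact_mod_cast this
  K_le := by
    have : K ≤ constBound t K := by unfold constBound; omega
    exact_mod_cast this
  code_le := by
    intro z hz
    have : Encodable.encode z + 1 ≤ ((box t K).map fun z => Encodable.encode z + 1).sum :=
      List.le_sum_of_mem (List.mem_map_of_mem (f := fun z => Encodable.encode z + 1) hz)
    have : Encodable.encode z + 1 ≤ constBound t K := by unfold constBound; omega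
    exact_mod_cast this
  -- The exponent `3 L + 4 c²` yields `M³ · 2 ^ (4 c²)`, and `4 c² ≤ 2 ^ (4 c²)`.
  le_B := by
    simp only [lengthBound, Polynomial.eval_add, Polynomial.eval_mul, Polynomial.eval_X,
      Polynomial.eval_C, Polynomial.eval_ofNat]
    rw [pow_add, mul_comm 3, pow_mul]
    have : 4 * constBound t K ^ 2 ≤ 2 ^ (4 * constBound t K ^ 2) := Nat.lt_two_pow_self.le
    have h : (4 * (constBound t K : ℤ) ^ 2) ≤ 2 ^ (4 * constBound t K ^ 2) := by exact_mod_cast this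
    have := mul_le_mul_of_nonneg_left h
      (by positivity : (0 : ℤ) ≤ (2 ^ inputLength w b l u) ^ 3)
    linarith
  abs_w i hi j := by
    rw [extend_colAddr w hi]
    exact abs_le_two_pow w (by unfold inputLength; omega) _
  abs_l i hi j := by
    rw [extend_colAddr l hi]
    exact abs_le_two_pow l (by unfold inputLength; omega) _
  abs_u i hi j := by
    rw [extend_colAddr u hi]
    exact abs_le_two_pow u (by unfold inputLength; omega) _
  l_le_x i hi j := by
    rw [extend_colAddr l hi, extend_colAddr x hi]
    exact hl _
  x_le_u i hi j := by
    rw [extend_colAddr u hi, extend_colAddr x hi]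
    exact hu _

variable {K w b l u x} {hl : l ≤ x} {hu : x ≤ u} {A : Bimatrix r s t} {γ : ℤ}

theorem loaded_initial : (Env.ofInstance K w b l u x hl hu).Loaded (initial w b l u x) :=
  ⟨by simp [initial, Env.ofInstance], rfl, rfl, rfl, rfl⟩

theorem pathCost_ofInstance {S : ℕ → Fin t → ℤ} {g : Col t n → ℤ}
    (hg : ∀ (i : Fin n) j, g (i, j) = (S (i + 1) - S i) j) :
    (Env.ofInstance K w b l u x hl hu).pathCost S = w ⬝ᵥ g := by
  change ∑ i ∈ Finset.range n, _ = _
  rw [Finset.sum_range, dotProduct, Fintype.sum_prod_type]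
  refine Finset.sum_congr rfl fun i _ => Finset.sum_congr rfl fun j _ => ?_
  rw [hg]
  change Function.extend colAddr w 0 _ * _ = _
  rw [extend_colAddr w i.2]

/-- The sum of the bricks telescopes to the last partial sum, which `A₁` annihilates; `A₂`
annihilates each brick by the choice of moves. -/
theorem mulVec_eq_zero_of_isPath {S : ℕ → Fin t → ℤ} {g : Col t n → ℤ}
    (hg : ∀ (i : Fin n) j, g (i, j) = (S (i + 1) - S i) j)
    (hS : (Env.ofInstance K w b l u x hl hu).IsPath A γ S) : (A.nFold n).mulVec g = 0 := by
  have hg' : ∀ i : Fin n, (fun j => g (i, j)) = S (i + 1) - S i := fun i => funext (hg i)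
  rw [nFold_mulVec_eq_iff]
  simp only [hg']
  refine ⟨?_, fun i => (mem_moves.1 (hS.2.1 i i.2).1).2.1⟩
  rw [← Finset.sum_range (fun i => S (i + 1) - S i), Finset.sum_range_sub, hS.1, sub_zero]
  exact hS.2.2

theorem feasibleStep_of_isPath {S : ℕ → Fin t → ℤ} {g : Col t n → ℤ}
    (hg : ∀ (i : Fin n) j, g (i, j) = (S (i + 1) - S i) j)
    (hS : (Env.ofInstance K w b l u x hl hu).IsPath A γ S) (hx : (A.nFold n).mulVec x = b) :
    FeasibleStep (A.nFold n) b l u x (γ • g) := by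
  refine ⟨?_, ?_, ?_⟩
  · rw [Matrix.mulVec_add, Matrix.mulVec_smul, mulVec_eq_zero_of_isPath hg hS, smul_zero, add_zero,
      hx]
  · rintro ⟨i, j⟩
    have : Function.extend colAddr l 0 _ ≤ Function.extend colAddr x 0 _ + γ * _ :=
      (hS.2.1 i i.2).2.1 j
    rw [extend_colAddr l i.2, extend_colAddr x i.2, ← hg] at this
    exact this
  · rintro ⟨i, j⟩
    have : Function.extend colAddr x 0 _ + γ * _ ≤ Function.extend colAddr u 0 _ :=
      (hS.2.1 i i.2).2.2 j
    rw [extend_colAddr u i.2, extend_colAddr x i.2, ← hg] at this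
    exact this

/-- The brick of `g` at position `i`. -/
def brick (g : Col t n → ℤ) (i : ℕ) : Fin t → ℤ :=
  if h : i < n then fun j => g (⟨i, h⟩, j) else 0

/-- The partial sums of the bricks of `g`. -/
def partialSum (g : Col t n → ℤ) (i : ℕ) : Fin t → ℤ := ∑ k ∈ Finset.range i, brick g k

theorem partialSum_succ_sub (g : Col t n → ℤ) (i : ℕ) :
    partialSum g (i + 1) - partialSum g i = brick g i := by
  rw [partialSum, Finset.sum_range_succ, partialSum, add_sub_cancel_left]

theorem partialSum_spec (g : Col t n → ℤ) (i : Fin n) (j : Fin t) :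
    g (i, j) = (partialSum g (i + 1) - partialSum g i) j := by
  rw [partialSum_succ_sub, brick, dif_pos i.2]

theorem sum_abs_brick (g : Col t n → ℤ) (j : Fin t) :
    ∑ k ∈ Finset.range n, |brick g k j| ≤ ∑ p, |g p| := by
  rw [Finset.sum_range, Fintype.sum_prod_type]
  refine Finset.sum_le_sum fun i _ => ?_
  rw [brick, dif_pos i.2]
  exact Finset.single_le_sum (f := fun j => |g (i, j)|) (fun _ _ => abs_nonneg _)
    (Finset.mem_univ j)

/-- Each coordinate of a partial sum is bounded by the 1-norm of `g`, so the path stays in the box.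
-/
theorem isPath_partialSum {g : Col t n → ℤ} (hg : (A.nFold n).mulVec g = 0)
    (hK : ∑ p, |g p| ≤ K) (hγl : l ≤ x + γ • g) (hγu : x + γ • g ≤ u) :
    (Env.ofInstance K w b l u x hl hu).IsPath A γ (partialSum g) := by
  obtain ⟨h1, h2⟩ := (nFold_mulVec_eq_iff A g 0).1 hg
  have hbox : ∀ i ≤ n, partialSum g i ∈ box t K := fun i hi => mem_box.2 fun j => by
    rw [partialSum, Finset.sum_apply]
    refine (Finset.abs_sum_le_sum_abs _ _).trans (le_trans ?_ ((sum_abs_brick g j).trans hK))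
    exact Finset.sum_le_sum_of_subset_of_nonneg (Finset.range_mono hi) fun _ _ _ => abs_nonneg _
  refine ⟨by simp [partialSum], fun i hi => ⟨mem_moves.2 ⟨mem_box.2 fun j => ?_, ?_, ?_⟩, ?_, ?_⟩,
    ?_⟩
  · rw [partialSum_succ_sub]
    exact (Finset.single_le_sum (f := fun k => |brick g k j|) (fun _ _ => abs_nonneg _)
      (Finset.mem_range.2 hi)).trans ((sum_abs_brick g j).trans hK)
  · have hi' : i < n := hi
    rw [partialSum_succ_sub, brick, dif_pos hi']
    exact h2 _
  · rw [add_sub_cancel]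
    exact hbox _ hi
  · intro j
    change Function.extend colAddr l 0 _ ≤ Function.extend colAddr x 0 _ + γ * _
    rw [extend_colAddr l hi, extend_colAddr x hi, ← partialSum_spec g ⟨i, hi⟩]
    exact hγl _
  · intro j
    change Function.extend colAddr x 0 _ + γ * _ ≤ Function.extend colAddr u 0 _
    rw [extend_colAddr u hi, extend_colAddr x hi, ← partialSum_spec g ⟨i, hi⟩]
    exact hγu _
  · change A.fst.mulVec (partialSum g n) = 0
    rw [partialSum, Finset.sum_range]
    simp only [brick, Fin.is_lt, dite_true]
    exact h1

/-- The largest step size for a direction is one of the sizes tried by the program. -/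
theorem exists_size {g : Col t n → ℤ} (hg0 : g ≠ 0) (hK : ∑ p, |g p| ≤ K) {m : ℤ} (hm : 1 ≤ m)
    (hml : l ≤ x + m • g) (hmu : x + m • g ≤ u) :
    ∃ γ, m ≤ γ ∧ l ≤ x + γ • g ∧ x + γ • g ≤ u ∧ ∃ i < n, ∃ j, ∃ k < K,
      γ = (Env.ofInstance K w b l u x hl hu).upSize i j (k + 1 : ℕ) ∨
        γ = (Env.ofInstance K w b l u x hl hu).downSize i j (k + 1 : ℕ) := by
  classical
  -- For `g p ≠ 0`, this is the largest step allowed by coordinate `p`: the upper bound limits it if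
  -- `g p > 0`, the lower bound if `g p < 0`. The least of these, at the coordinate chosen next, is
  -- the largest step for `g`.
  let c : Col t n → ℤ := fun p => if 0 < g p then (u p - x p) / g p else (x p - l p) / (-g p)
  obtain ⟨q, hq⟩ := Function.ne_iff.1 hg0
  obtain ⟨p, hp, hmin⟩ := Finset.exists_min_image (Finset.univ.filter fun p => g p ≠ 0) c
    ⟨q, by simpa using hq⟩
  have hp0 : g p ≠ 0 := by simpa using hp
  have hc : ∀ q, g q ≠ 0 → ∀ γ, 0 ≤ γ → (γ ≤ c q ↔ l q ≤ x q + γ * g q ∧ x q + γ * g q ≤ u q) := by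
    intro q hq γ hγ
    have h1 := hl q
    have h2 := hu q
    simp only [c]
    split_ifs with h
    · rw [Int.le_ediv_iff_mul_le h]
      have := mul_nonneg hγ h.le
      constructor
      · intro h'
        constructor <;> linarith
      · rintro ⟨-, h'⟩
        linarith
    · have hneg : 0 < -g q := by omega
      rw [Int.le_ediv_iff_mul_le hneg]
      have := mul_nonneg hγ hneg.le
      constructor
      · intro h'
        constructor <;> linarith
      · rintro ⟨h', -⟩
        linarith
  have hmc : m ≤ c p := (hc p hp0 m (by linarith)).2 ⟨hml p, hmu p⟩
  have hall : ∀ q, l q ≤ x q + c p * g q ∧ x q + c p * g q ≤ u q := by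
    intro q
    by_cases hq : g q = 0
    · rw [hq, mul_zero, add_zero]
      exact ⟨hl q, hu q⟩
    · exact (hc q hq (c p) (by linarith)).1 (hmin q (by simpa using hq))
  -- The program divides by `k + 1` with `k < K`, hence the index `|g p| - 1`.
  refine ⟨c p, hmc, fun q => (hall q).1, fun q => (hall q).2, p.1, p.1.2, p.2, (g p).natAbs - 1,
    ?_, ?_⟩
  · have : |g p| ≤ K := (Finset.single_le_sum (f := fun p => |g p|) (fun _ _ => abs_nonneg _)
      (Finset.mem_univ p)).trans hK
    rw [Int.abs_eq_natAbs] at this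
    omega
  · have hk : (g p).natAbs - 1 + 1 = (g p).natAbs := by omega
    rw [hk]
    simp only [c]
    split_ifs with h
    · left
      change _ = (Function.extend colAddr u 0 _ - Function.extend colAddr x 0 _) / _
      rw [extend_colAddr u p.1.2, extend_colAddr x p.1.2, Int.natCast_natAbs, abs_of_pos h]
    · right
      change _ = (Function.extend colAddr x 0 _ - Function.extend colAddr l 0 _) / _
      rw [extend_colAddr l p.1.2, extend_colAddr x p.1.2, Int.natCast_natAbs,
        abs_of_nonpos (by omega)]

end Instance

end NFold

/-! ### Comparison with all Graver steps -/

theorem mainTheorem7 {r s t : ℕ} (A : NFold.Bimatrix r s t) :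
    ∃ (prog : NFold.Prog) (C : ℕ) (P : Polynomial ℕ),
      ∀ (n : ℕ), 0 < n →
      ∀ (w : NFold.Col t n → ℤ) (b : NFold.Row r s n → ℤ) (l u x : NFold.Col t n → ℤ),
        NFold.Feasible (A.nFold n) b l u x →
        ∃ (steps : ℕ) (τ : NFold.State),
          NFold.Exec (2 ^ P.eval (NFold.inputLength w b l u)) prog (NFold.initial w b l u x)
            steps τ ∧
          steps ≤ C * n ^ 2 ∧
          0 < NFold.outSize τ ∧
          NFold.FeasibleStep (A.nFold n) b l u x (NFold.outSize τ • NFold.outDir t n τ) ∧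
          ∀ (γ : ℕ) (g : NFold.Col t n → ℤ), g ∈ NFold.graverBasis (A.nFold n) →
            NFold.FeasibleStep (A.nFold n) b l u x (γ • g) →
            w ⬝ᵥ (x + NFold.outSize τ • NFold.outDir t n τ) ≤ w ⬝ᵥ (x + γ • g) := by
  obtain ⟨K, hK⟩ := NFold.exists_graverBasis_nFold_bound A
  refine ⟨NFold.graverBest A K, 4 * NFold.graverBestCost A K, NFold.lengthBound t K, ?_⟩
  rintro n hn w b l u x ⟨hx, hl, hu⟩
  obtain ⟨steps, τ, hexec, hsteps, h1, S, hS, hS0, hout, hbeat⟩ :=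
    NFold.graverBest_twp (NFold.Env.ofInstance K w b l u x hl hu) A NFold.loaded_initial
  have hdir : ∀ (i : Fin n) j, NFold.outDir t n τ (i, j) = (S (i + 1) - S i) j :=
    fun i j => hout i i.2 j
  rw [NFold.pathCost_ofInstance hdir] at hS0 hbeat
  refine ⟨steps, τ, hexec, hsteps.trans ?_, h1, NFold.feasibleStep_of_isPath hdir hS hx, ?_⟩
  · change _ * (n + 1) ^ 2 ≤ _
    have : (n + 1) ^ 2 ≤ 4 * n ^ 2 := by nlinarith
    calc _ ≤ NFold.graverBestCost A K * (4 * n ^ 2) := Nat.mul_le_mul_left _ this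
      _ = _ := by ring
  · rintro γ g hg ⟨-, hγl, hγu⟩
    rw [dotProduct_add, dotProduct_add, dotProduct_smul, dotProduct_smul]
    refine add_le_add_right ?_ _
    rw [smul_eq_mul, nsmul_eq_mul]
    -- The output has value at most `0`, so only improving directions with a positive step remain.
    rcases le_or_gt 0 (w ⬝ᵥ g) with hw | hw
    · exact hS0.trans (mul_nonneg (Nat.cast_nonneg γ) hw)
    rcases Nat.eq_zero_or_pos γ with rfl | hγ
    · rw [Nat.cast_zero, zero_mul]
      exact hS0
    rw [← natCast_zsmul] at hγl hγu
    -- The given step is lengthened to the largest feasible one, which the program has tried; since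
    -- `w g < 0`, this does not increase the objective.
    obtain ⟨m, hγm, hml, hmu, i, hi, j, k, hk, hm⟩ := NFold.exists_size (K := K) (w := w) (b := b)
      (hl := hl) (hu := hu) hg.2.1 (hK n g hg) (by exact_mod_cast hγ) hγl hγu
    have hpath := NFold.isPath_partialSum (w := w) (b := b) (hl := hl) (hu := hu) hg.1 (hK n g hg)
      hml hmu
    have hm1 : 1 ≤ m := le_trans (by exact_mod_cast hγ) hγm
    have hle : NFold.outSize τ * w ⬝ᵥ NFold.outDir t n τ ≤ m * w ⬝ᵥ g := by
      rw [← NFold.pathCost_ofInstance (K := K) (b := b) (hl := hl) (hu := hu)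
        (NFold.partialSum_spec g)]
      rcases hm with rfl | rfl
      · exact (hbeat i hi j k hk).1 hm1 _ hpath
      · exact (hbeat i hi j k hk).2 hm1 _ hpath
    exact hle.trans (mul_le_mul_of_nonpos_right hγm hw.le)
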